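/- **Theorem.** Fix constants $\varepsilon>0$ and $c>0$. There are a deterministic Congested Clique algorithm and a deterministic linear-memory MPC algorithm, and constants $\beta, R_1, R_2, C, b$ depending only on $\varepsilon$ and $c$, such that the following holds. Let $G=(V,E)$ be a graph with $V=\{0,\dots,n-1\}$, with $m$ edges and maximum degree $\Delta \ge c\,(\log n)^{4/(3\varepsilon)}$, and let $f$ be a real number with $1\le f\le\sqrt{\Delta}$. Then there is a set $Z\subseteq V$ such that 1. $|E(G[Z])| \le \beta\, m/f^2$; 2. every vertex $v\in V\setminus Z$ with $|N(v)|\ge f\Delta^{\varepsilon}$ has a neighbour in $Z$; 3. the Congested Clique algorithm computes $Z$ in $R_1 = O(1)$ rounds: each of the $n$ nodes initially knows $n$, its identifier, its neighbours in $G$ and $\lfloor f\rfloor$; in each round each node sends to each node a message of at most $b(\lfloor\log_2 n\rfloor+1)=O(\log n)$ bits; in the end each node knows whether it is in $Z$; 4. the MPC algorithm computes the same set $Z$ in $R_2=O(1)$ rounds, for every memory parameter $S\ge n$ (in particular $S=\Theta(n)$ or $S=\tilde{\Theta}(n)$), every number $M$ of machines, and every distribution of the edges of $G$ (each edge on exactly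 one machine, two words per edge) in which each machine gets at most $S$ words: each machine knows $n$, $S$, $M$, its identifier and $\lfloor f\rfloor$, always stores at most $CS$ words, sends at most $CS$ words and receives at most $CS$ words in each round, and outputs at most $CS$ words, where a word has at most $b(\lfloor\log_2 n\rfloor+1)=O(\log n)$ bits; the set $Z$ is the union of the sets of vertices that the machines output. In both models the local computations are given by computable functions that are the same for all $n$, $f$, all graphs, and all nodes or machines (and all $S$, $M$); there is no other bound on local computation. -/

import Mathlib

/-!
Distributed models of computation on graphs with vertex set `Fin n`.

Local computation is arbitrary but computable; all algorithms are deterministic and uniform, that is,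
one and the same program is used for all `n`, all graphs, all nodes and all machines. A program may
take one natural number `q` as a parameter (the same for all nodes or machines).
-/

/-- The list of the neighbours of `v`, in increasing order. -/
def neighborList {n : ℕ} (G : SimpleGraph (Fin n)) [DecidableRel G.Adj] (v : Fin n) : List ℕ :=
  ((List.finRange n).filter fun u => G.Adj v u).map Fin.val

/-! ### The Congested Clique -/

/-- Everything that a node of the Congested Clique knows at some moment: `(n, q, v, N, T)`, where
`n` is the number of nodes, `q` is the parameter of the algorithm, `v` is the identifier of the node,
`N` is the list of its neighbours in the input graph and `T` is the list of the rounds so far; for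
each round, `T` holds the list of the `n` messages received (entry `u` comes from node `u`). -/
abbrev CliqueView : Type := ℕ × ℕ × ℕ × List ℕ × List (List ℕ)

/-- A deterministic algorithm in the Congested Clique. Nodes have unbounded memory, so that messages
and outputs are functions of all that the node has seen. `send x u` is the message that a node with
view `x` sends to node `u`; `output x` says whether a node with view `x` joins the output set. -/
structure CliqueAlgorithm where
  send : CliqueView → ℕ → ℕ
  output : CliqueView → Bool
  send_computable : Computable₂ send
  output_computable : Computable output

namespace CliqueAlgorithm

variable (A : CliqueAlgorithm) {n : ℕ} (G : SimpleGraph (Fin n)) [DecidableRel G.Adj] (q : ℕ)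

/-- The messages received by each node during the first `t` rounds. -/
def transcript : ℕ → Fin n → List (List ℕ)
  | 0 => fun _ => []
  | t + 1 => fun v => transcript t v ++
      [List.ofFn fun u : Fin n => A.send (n, q, (u : ℕ), neighborList G u, transcript t u) (v : ℕ)]

/-- The view of node `v` after `t` rounds. -/
def view (t : ℕ) (v : Fin n) : CliqueView :=
  (n, q, (v : ℕ), neighborList G v, A.transcript G q t v)

/-- On the input graph `G` with parameter `q`, the algorithm `A` uses messages of at most `bits` bits
and after `rounds` rounds it has computed the vertex set `Z`: each node knows whether it is in `Z`. -/
def Computes (rounds bits : ℕ) (Z : Finset (Fin n)) : Prop :=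
  (∀ t < rounds, ∀ u v : Fin n, Nat.size (A.send (A.view G q t u) (v : ℕ)) ≤ bits) ∧
  ∀ v : Fin n, v ∈ Z ↔ A.output (A.view G q rounds v) = true

end CliqueAlgorithm

/-! ### Massively Parallel Computation -/

/-- What is known to an MPC machine besides its memory: `(n, S, M, q, i)`, where `n` is the number
of vertices of the input graph, `S` is the memory parameter, `M` is the number of machines, `q` is
the parameter of the algorithm and `i` is the identifier of the machine. -/
abbrev MPCContext : Type := ℕ × ℕ × ℕ × ℕ × ℕ

/-- A deterministic MPC algorithm. The memory of a machine is a list of words, and so is a message.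
In round `t`, a machine with context `c` and memory `s` sends the message `send (c, t, s) j` to
machine `j`; if it receives the messages `r` (entry `j` of `r` comes from machine `j`), then its new
memory is `update (c, t, s, r)`. A machine with context `c` and final memory `s` outputs the
vertices in the list `output (c, s)`. -/
structure MPCAlgorithm where
  send : MPCContext × ℕ × List ℕ → ℕ → List ℕ
  update : MPCContext × ℕ × List ℕ × List (List ℕ) → List ℕ
  output : MPCContext × List ℕ → List ℕ
  send_computable : Computable₂ send
  update_computable : Computable update
  output_computable : Computable output

/-- The edges of `G` are distributed over `M` machines: the lists `input i` together contain each
edge of `G` exactly once, in one of its two orientations, and contain nothing else; and each list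
fits in `S` words (two words per edge). -/
def IsDistribution {n M : ℕ} (G : SimpleGraph (Fin n)) [DecidableRel G.Adj] (S : ℕ)
    (input : Fin M → List (Fin n × Fin n)) : Prop :=
  (∀ e : Sym2 (Fin n),
    ∑ i, ((input i).map fun p => s(p.1, p.2)).count e = if e ∈ G.edgeSet then 1 else 0) ∧
  ∀ i, 2 * (input i).length ≤ S

namespace MPCAlgorithm

variable (B : MPCAlgorithm) {n M : ℕ} (S q : ℕ) (input : Fin M → List (Fin n × Fin n))

/-- The memory of each machine after `t` rounds; at the start it holds that machine's share of the
input, two words per edge. -/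
def memory : ℕ → Fin M → List ℕ
  | 0 => fun i => (input i).flatMap fun p => [(p.1 : ℕ), (p.2 : ℕ)]
  | t + 1 => fun i => B.update ((n, S, M, q, (i : ℕ)), t, memory t i,
      List.ofFn fun j : Fin M => B.send ((n, S, M, q, (j : ℕ)), t, memory t j) (i : ℕ))

/-- The message sent by machine `i` to machine `j` in round `t`. -/
def message (t : ℕ) (i j : Fin M) : List ℕ :=
  B.send ((n, S, M, q, (i : ℕ)), t, B.memory S q input t i) (j : ℕ)

/-- The list of vertices that machine `i` outputs after `t` rounds. -/
def result (t : ℕ) (i : Fin M) : List ℕ :=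
  B.output ((n, S, M, q, (i : ℕ)), B.memory S q input t i)

/-- On the given distributed input, with parameter `q`, the algorithm `B` computes in `rounds` rounds
the vertex set `Z`, which is the union of the outputs of the machines; at all times each machine
has at most `words` words in its memory, in each round it sends at most `words` words and receives
at most `words` words, it outputs at most `words` words, and all words have at most `bits` bits. -/
def Computes (rounds words bits : ℕ) (Z : Finset (Fin n)) : Prop :=
  (∀ t ≤ rounds, ∀ i, (B.memory S q input t i).length ≤ words ∧
    ∀ x ∈ B.memory S q input t i, Nat.size x ≤ bits) ∧
  (∀ t < rounds, ∀ i,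
    ∑ j, (B.message S q input t i j).length ≤ words ∧
    ∑ j, (B.message S q input t j i).length ≤ words ∧
    ∀ j, ∀ x ∈ B.message S q input t i j, Nat.size x ≤ bits) ∧
  (∀ i, (B.result S q input rounds i).length ≤ words) ∧
  ∀ v : Fin n, v ∈ Z ↔ ∃ i, (v : ℕ) ∈ B.result S q input rounds i

end MPCAlgorithm

-- Put `q = ⌊f⌋₊`, so that `f < 2q`. If every vertex is sampled independently with probability
-- `1/q`, a given edge survives with probability `1/q²`, and a neighbourhood of size `d` is missed
-- with probability at most `(1 - 1/q) ^ d ≤ 2 ^ (-⌊d/q⌋)`. For `d ≥ f * Δ ^ ε` and large `n` this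
-- is at most `n⁻⁶`, because `Δ ^ ε` dominates `log n`.
--
-- The randomness is removed in two stages. The first stage does not see the graph. By a union bound
-- (`exists_table`) there is a table of `n ^ 5` vertex sets in which each pair of vertices lies
-- together in at most `8 * n ^ 5 / q ^ 2` sets, and each large vertex set is disjoint from fewer
-- than `n` of them. Such a table depends on `n` and `q` only. Since local computation is only
-- required to be computable, every node and machine finds the same table by exhaustive search
-- (`tableCode`).
--
-- The second stage selects a set for the given graph. A set is charged twice its number of inner
-- edges, plus `n ^ 3` for each large neighbourhood that it misses. Averaged over the table this is
-- at most `(16 * m + q ^ 2) / q ^ 2 ≤ 17 * m / q ^ 2` (`mul_sum_graphCost_le`). An index of at most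
-- average cost has few inner edges, and it pays no penalty, as `n ^ 3` alone exceeds `17 * m`
-- (`chosen_set_spec`). The index has five digits in base `n`. They are fixed one by one by
-- conditional expectations (`pow_mul_chosenPrefix_le`); each digit has `n` candidates, whose costs
-- are sums of contributions of single vertices.
--
-- In the Congested Clique node `u` totals candidate `u` and announces the result: two rounds per
-- digit, ten in all. In MPC the whole neighbourhood of a vertex must first reach one machine. With
-- at least `n` machines, machine `v` takes vertex `v`. With fewer, degrees are aggregated and the
-- vertices are packed greedily by prefix sums of degrees divided by `S`, which gives a machine at
-- most `S + n` words (`length_received_le`). Three preparatory rounds and ten rounds for the digits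
-- make thirteen. Both algorithms follow the same `chosenPrefix`, hence obtain the same set. For `n
-- < n₀` every vertex is taken and a large `β` pays for it.

attribute [fun_prop] Primrec

/-! ### Primitive recursiveness by `fun_prop` -/

namespace Primrec

variable {α β σ : Type*} [Primcodable α] [Primcodable β] [Primcodable σ]

@[fun_prop]
theorem fun_id : Primrec fun a : α => a := Primrec.id

@[fun_prop]
theorem fun_const (x : σ) : Primrec fun _ : α => x := Primrec.const x

@[fun_prop]
theorem fun_comp {f : β → σ} {g : α → β} (hf : Primrec f) (hg : Primrec g) :
    Primrec fun a => f (g a) := hf.comp hg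

@[fun_prop]
theorem fun_pair {f : α → β} {g : α → σ} (hf : Primrec f) (hg : Primrec g) :
    Primrec fun a => (f a, g a) := hf.pair hg

@[fun_prop]
theorem fun_fst {f : α → β × σ} (hf : Primrec f) : Primrec fun a => (f a).1 := Primrec.fst.comp hf

@[fun_prop]
theorem fun_snd {f : α → β × σ} (hf : Primrec f) : Primrec fun a => (f a).2 := Primrec.snd.comp hf

@[fun_prop]
theorem fun_add {f g : α → ℕ} (hf : Primrec f) (hg : Primrec g) :
    Primrec fun a => f a + g a := Primrec.nat_add.comp hf hg

@[fun_prop]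
theorem fun_sub {f g : α → ℕ} (hf : Primrec f) (hg : Primrec g) :
    Primrec fun a => f a - g a := Primrec.nat_sub.comp hf hg

@[fun_prop]
theorem fun_mul {f g : α → ℕ} (hf : Primrec f) (hg : Primrec g) :
    Primrec fun a => f a * g a := Primrec.nat_mul.comp hf hg

@[fun_prop]
theorem fun_div {f g : α → ℕ} (hf : Primrec f) (hg : Primrec g) :
    Primrec fun a => f a / g a := Primrec.nat_div.comp hf hg

@[fun_prop]
theorem fun_mod {f g : α → ℕ} (hf : Primrec f) (hg : Primrec g) :
    Primrec fun a => f a % g a := Primrec.nat_mod.comp hf hg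

@[fun_prop]
theorem fun_min {f g : α → ℕ} (hf : Primrec f) (hg : Primrec g) :
    Primrec fun a => min (f a) (g a) := Primrec.nat_min.comp hf hg

@[fun_prop]
theorem fun_pow {f g : α → ℕ} (hf : Primrec f) (hg : Primrec g) :
    Primrec fun a => f a ^ g a :=
  (Primrec₂.unpaired'.1 Nat.Primrec.pow).comp hf hg

@[fun_prop]
theorem fun_ite_le {f g : α → ℕ} {h k : α → σ} (hf : Primrec f) (hg : Primrec g)
    (hh : Primrec h) (hk : Primrec k) :
    Primrec fun a => if f a ≤ g a then h a else k a :=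
  Primrec.ite (Primrec.nat_le.comp hf hg) hh hk

@[fun_prop]
theorem fun_ite_lt {f g : α → ℕ} {h k : α → σ} (hf : Primrec f) (hg : Primrec g)
    (hh : Primrec h) (hk : Primrec k) :
    Primrec fun a => if f a < g a then h a else k a :=
  Primrec.ite (Primrec.nat_lt.comp hf hg) hh hk

@[fun_prop]
theorem fun_ite_eq {f g : α → ℕ} {h k : α → σ} (hf : Primrec f) (hg : Primrec g)
    (hh : Primrec h) (hk : Primrec k) :
    Primrec fun a => if f a = g a then h a else k a :=
  Primrec.ite (Primrec.eq.comp hf hg) hh hk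

@[fun_prop]
theorem fun_decide_eq {f g : α → ℕ} (hf : Primrec f) (hg : Primrec g) :
    Primrec fun a => decide (f a = g a) :=
  (Primrec.eq.comp hf hg).decide

@[fun_prop]
theorem fun_sum_range {n : α → ℕ} {f : α → ℕ → ℕ} (hn : Primrec n)
    (hf : Primrec fun p : α × ℕ => f p.1 p.2) :
    Primrec fun a => ∑ i ∈ Finset.range (n a), f a i := by
  have h : Primrec₂ fun (a : α) (p : ℕ × ℕ) => p.2 + f a p.1 :=
    Primrec.nat_add.comp (Primrec.snd.comp Primrec.snd)
      (hf.comp (Primrec.fst.pair (Primrec.fst.comp Primrec.snd)))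
  refine (Primrec.nat_rec' hn (Primrec.const 0) h).of_eq fun a => ?_
  induction n a with
  | zero => rfl
  | succ k ih => rw [Finset.sum_range_succ, ← ih]

@[fun_prop]
theorem fun_map {l : α → List β} {f : α → β → σ} (hl : Primrec l)
    (hf : Primrec fun p : α × β => f p.1 p.2) : Primrec fun a => (l a).map (f a) :=
  Primrec.list_map hl hf

@[fun_prop]
theorem fun_flatMap {l : α → List β} {f : α → β → List σ} (hl : Primrec l)
    (hf : Primrec fun p : α × β => f p.1 p.2) : Primrec fun a => (l a).flatMap (f a) :=
  Primrec.list_flatMap hl hf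

@[fun_prop]
theorem fun_range {f : α → ℕ} (hf : Primrec f) : Primrec fun a => List.range (f a) :=
  Primrec.list_range.comp hf

@[fun_prop]
theorem fun_length {l : α → List β} (hl : Primrec l) : Primrec fun a => (l a).length :=
  Primrec.list_length.comp hl

@[fun_prop]
theorem fun_flatten {l : α → List (List β)} (hl : Primrec l) : Primrec fun a => (l a).flatten :=
  Primrec.list_flatten.comp hl

@[fun_prop]
theorem fun_getD {l : α → List β} {f : α → ℕ} {d : β} (hl : Primrec l) (hf : Primrec f) :
    Primrec fun a => (l a).getD (f a) d :=
  (Primrec.list_getD d).comp hl hf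

@[fun_prop]
theorem fun_cons {f : α → β} {l : α → List β} (hf : Primrec f) (hl : Primrec l) :
    Primrec fun a => f a :: l a :=
  Primrec.list_cons.comp hf hl

@[fun_prop]
theorem fun_append {k l : α → List β} (hk : Primrec k) (hl : Primrec l) :
    Primrec fun a => k a ++ l a :=
  Primrec.list_append.comp hk hl

@[fun_prop]
theorem fun_drop {f : α → ℕ} {l : α → List β} (hf : Primrec f) (hl : Primrec l) :
    Primrec fun a => (l a).drop (f a) :=
  Primrec.list_drop.comp hf hl

@[fun_prop]
theorem fun_take {f : α → ℕ} {l : α → List β} (hf : Primrec f) (hl : Primrec l) :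
    Primrec fun a => (l a).take (f a) :=
  Primrec.list_take.comp hf hl

@[fun_prop]
theorem fun_list_sum {l : α → List ℕ} (hl : Primrec l) : Primrec fun a => (l a).sum := by
  have h : Primrec₂ fun (_ : α) (p : ℕ × ℕ) => p.1 + p.2 :=
    Primrec.nat_add.comp (Primrec.fst.comp Primrec.snd) (Primrec.snd.comp Primrec.snd)
  exact Primrec.list_foldr hl (Primrec.const 0) h

@[fun_prop]
theorem fun_findGreatest_le {n : α → ℕ} {f g : α → ℕ → ℕ} (hn : Primrec n)
    (hf : Primrec fun p : α × ℕ => f p.1 p.2) (hg : Primrec fun p : α × ℕ => g p.1 p.2) :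
    Primrec fun a => Nat.findGreatest (fun i => f a i ≤ g a i) (n a) :=
  Primrec.nat_findGreatest hn (p := fun a i => f a i ≤ g a i) (Primrec.nat_le.comp hf hg)

end Primrec

/-! ### A table of vertex sets -/

/-- The bit of the table with code `c` that says whether vertex `v` is in the set with index `s`. -/
def tableBit (n c s v : ℕ) : ℕ := c / 2 ^ (s * n + v) % 2

@[fun_prop]
theorem primrec_tableBit {α : Type*} [Primcodable α] {n c s v : α → ℕ} (hn : Primrec n)
    (hc : Primrec c) (hs : Primrec s) (hv : Primrec v) :
    Primrec fun a => tableBit (n a) (c a) (s a) (v a) := by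
  unfold tableBit
  fun_prop

/-- The number of pairs of vertices that lie together in too many of the `n ^ 5` sets. -/
def pairDefects (n q c : ℕ) : ℕ :=
  ∑ u ∈ Finset.range n, ∑ v ∈ Finset.range n, if u = v then 0 else
    if 8 * n ^ 5 < q ^ 2 * ∑ s ∈ Finset.range (n ^ 5), tableBit n c s u * tableBit n c s v
    then 1 else 0

/-- The number of large vertex sets that are disjoint from too many of the `n ^ 5` sets. -/
def missDefects (n q c : ℕ) : ℕ :=
  ∑ N ∈ Finset.range (2 ^ n),
    if n ^ 6 ≤ 2 ^ ((∑ v ∈ Finset.range n, tableBit n N 0 v) / q) then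
      if n ≤ ∑ s ∈ Finset.range (n ^ 5),
          (if ∑ v ∈ Finset.range n, tableBit n N 0 v * tableBit n c s v = 0 then 1 else 0)
      then 1 else 0
    else 0

/-- The code of a table without defects, if there is one. -/
def tableCode (n q : ℕ) : ℕ :=
  Nat.findGreatest (fun c => pairDefects n q c + missDefects n q c ≤ 0) (2 ^ (n ^ 6))

/-- Whether vertex `v` is in the set with index `s`; for `n < n₀` all vertices are. -/
def member (n₀ n q s v : ℕ) : ℕ := if n < n₀ then 1 else tableBit n (tableCode n q) s v

@[fun_prop]
theorem primrec_member {α : Type*} [Primcodable α] (n₀ : ℕ) {n q s v : α → ℕ} (hn : Primrec n)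
    (hq : Primrec q) (hs : Primrec s) (hv : Primrec v) :
    Primrec fun a => member n₀ (n a) (q a) (s a) (v a) := by
  unfold member tableCode pairDefects missDefects
  fun_prop

/-! ### Existence of the table, by counting bad tuples of maps -/

open Finset in
/-- A union bound for tuples that hit a given set at least `r` times. -/
theorem card_filter_le_card_hits {Ω : Type*} [Fintype Ω] [DecidableEq Ω] (K r : ℕ)
    (A : Finset Ω) :
    #{t : Fin K → Ω | r ≤ #{s | t s ∈ A}} ≤
      K.choose r * (#A ^ r * Fintype.card Ω ^ (K - r)) := by
  classical
  have hsub : ({t : Fin K → Ω | r ≤ #{s | t s ∈ A}} : Finset _) ⊆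
      (powersetCard r univ).biUnion fun T : Finset (Fin K) =>
        Fintype.piFinset fun s => if s ∈ T then A else univ := by
    intro t ht
    obtain ⟨T, hT, hTr⟩ := exists_subset_card_eq (mem_filter.1 ht).2
    refine mem_biUnion.2 ⟨T, mem_powersetCard.2 ⟨subset_univ _, hTr⟩, ?_⟩
    rw [Fintype.mem_piFinset]
    intro s
    split_ifs with hs
    · exact (mem_filter.1 (hT hs)).2
    · exact mem_univ _
  refine (card_le_card hsub).trans (card_biUnion_le.trans ?_)
  have hcard : ∀ T ∈ powersetCard r (univ : Finset (Fin K)),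
      #(Fintype.piFinset fun s => if s ∈ T then A else univ) =
        #A ^ r * Fintype.card Ω ^ (K - r) := by
    intro T hT
    have hTr := (mem_powersetCard.1 hT).2
    rw [Fintype.card_piFinset]
    have : ∀ s, #(if s ∈ T then A else univ) = if s ∈ T then #A else Fintype.card Ω := by
      intro s; split_ifs <;> simp
    simp only [this]
    rw [prod_ite, prod_const, prod_const, filter_mem_eq_inter, univ_inter, hTr]
    congr 2
    rw [filter_not, filter_mem_eq_inter, univ_inter, ← compl_eq_univ_sdiff, card_compl, hTr,
      Fintype.card_fin]
  rw [sum_congr rfl hcard, sum_const, card_powersetCard, card_univ, Fintype.card_fin,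
    smul_eq_mul]

/-- With `q = k + 1` this is `(1 - 1/q) ^ q ≤ 1/2`. The inner claim is Bernoulli's inequality `(1 +
1/k) ^ m ≥ 1 + m/k` with denominators cleared. -/
theorem two_mul_pow_succ_le (k : ℕ) : 2 * k ^ (k + 1) ≤ (k + 1) ^ (k + 1) := by
  have h : ∀ m, k ^ m * (k + m) ≤ k * (k + 1) ^ m := by
    intro m
    induction m with
    | zero => simp
    | succ m ih =>
      calc k ^ (m + 1) * (k + (m + 1)) ≤ k ^ m * (k + m) * (k + 1) := by
            have : 0 ≤ k ^ m * m := Nat.zero_le _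
            rw [pow_succ]; nlinarith
        _ ≤ k * (k + 1) ^ m * (k + 1) := Nat.mul_le_mul_right _ ih
        _ = k * (k + 1) ^ (m + 1) := by ring
  rcases Nat.eq_zero_or_pos k with rfl | hk
  · simp
  · refine Nat.le_of_mul_le_mul_left ?_ hk
    calc k * (2 * k ^ (k + 1)) ≤ k ^ (k + 1) * (k + (k + 1)) := by
          have : 0 ≤ k ^ (k + 1) := Nat.zero_le _
          nlinarith
      _ ≤ k * (k + 1) ^ (k + 1) := h _

theorem two_pow_mul_pred_pow_le {q : ℕ} (d : ℕ) (hq : 1 ≤ q) :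
    2 ^ (d / q) * (q - 1) ^ d ≤ q ^ d := by
  have h1 : 2 * (q - 1) ^ q ≤ q ^ q := by
    obtain ⟨k, rfl⟩ := Nat.exists_eq_add_of_le' hq
    exact two_mul_pow_succ_le k
  calc 2 ^ (d / q) * (q - 1) ^ d
      = (2 * (q - 1) ^ q) ^ (d / q) * (q - 1) ^ (d % q) := by
        rw [mul_pow, ← pow_mul, mul_assoc, ← pow_add, Nat.div_add_mod]
    _ ≤ (q ^ q) ^ (d / q) * q ^ (d % q) :=
        Nat.mul_le_mul (Nat.pow_le_pow_left h1 _) (Nat.pow_le_pow_left (Nat.sub_le _ _) _)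
    _ = q ^ d := by rw [← pow_mul, ← pow_add, Nat.div_add_mod]

-- A uniform map to `Fin q` samples the vertices that it sends to `0`; by independence it misses `N`
-- with probability `(1 - 1/q) ^ #N`.
open Finset in
theorem card_missing_le {n q : ℕ} (hq : 1 ≤ q) (N : Finset (Fin n)) [NeZero q] :
    #{h : Fin n → Fin q | ∀ v ∈ N, h v ≠ 0} * 2 ^ (#N / q) ≤ q ^ n := by
  classical
  have hA : ({h : Fin n → Fin q | ∀ v ∈ N, h v ≠ 0} : Finset _) =
      Fintype.piFinset fun v => if v ∈ N then {0}ᶜ else univ := by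
    ext h
    simp only [mem_filter, mem_univ, true_and, Fintype.mem_piFinset]
    refine forall_congr' fun v => ?_
    split_ifs with hv <;> simp [hv]
  have hcard : ∀ v, #(if v ∈ N then ({0}ᶜ : Finset (Fin q)) else univ) =
      if v ∈ N then q - 1 else q := by
    intro v; split_ifs <;> simp [card_compl]
  rw [hA, Fintype.card_piFinset]
  simp only [hcard]
  rw [prod_ite, prod_const, prod_const, filter_mem_eq_inter, univ_inter, filter_not,
    filter_mem_eq_inter, univ_inter, ← compl_eq_univ_sdiff, card_compl, Fintype.card_fin]
  have hN : #N ≤ n := by simpa using card_le_univ N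
  calc (q - 1) ^ #N * q ^ (n - #N) * 2 ^ (#N / q)
      = (2 ^ (#N / q) * (q - 1) ^ #N) * q ^ (n - #N) := by ring
    _ ≤ q ^ #N * q ^ (n - #N) := Nat.mul_le_mul_right _ (two_pow_mul_pred_pow_le _ hq)
    _ = q ^ n := by rw [← pow_add, Nat.add_sub_cancel' hN]

open Finset in
theorem card_both_le {n q : ℕ} [NeZero q] {u v : Fin n} (huv : u ≠ v) :
    #{h : Fin n → Fin q | h u = 0 ∧ h v = 0} * q ^ 2 ≤ q ^ n := by
  classical
  have hA : ({h : Fin n → Fin q | h u = 0 ∧ h v = 0} : Finset _) =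
      Fintype.piFinset fun w => if w ∈ ({u, v} : Finset (Fin n)) then {0} else univ := by
    ext h
    simp only [mem_filter, mem_univ, true_and, Fintype.mem_piFinset]
    constructor
    · rintro ⟨h1, h2⟩ w
      split_ifs with hw
      · simp only [mem_insert, mem_singleton] at hw
        rcases hw with rfl | rfl <;> simp [*]
      · simp
    · intro h'
      have h1 := h' u
      have h2 := h' v
      simpa using And.intro h1 h2
  have hcard : ∀ w, #(if w ∈ ({u, v} : Finset (Fin n)) then ({0} : Finset (Fin q)) else univ) =
      if w ∈ ({u, v} : Finset (Fin n)) then 1 else q := by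
    intro w; split_ifs <;> simp
  rw [hA, Fintype.card_piFinset]
  simp only [hcard]
  have h2 : #({u, v} : Finset (Fin n)) = 2 := card_pair huv
  have hN : 2 ≤ n := by rw [← h2]; simpa using card_le_univ ({u, v} : Finset (Fin n))
  rw [prod_ite, prod_const, prod_const, one_pow, one_mul, filter_not,
    filter_mem_eq_inter, univ_inter, ← compl_eq_univ_sdiff, card_compl, Fintype.card_fin, h2,
    ← pow_add, Nat.sub_add_cancel hN]

/-- If `r` is at least `8 * K / a`, then `choose K r` is at most `(a / 2) ^ r`. -/
theorem choose_mul_pow_le {K r a : ℕ} (h : 8 * K ≤ a * r) :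
    (K.choose r : ℝ) * 2 ^ r ≤ (a : ℝ) ^ r := by
  have h1 : (K.choose r : ℝ) ≤ (K : ℝ) ^ r / r.factorial := Nat.choose_le_pow_div r K
  have h2 : (r : ℝ) ^ r / r.factorial ≤ Real.exp r :=
    Real.pow_div_factorial_le_exp _ (by positivity) r
  -- The crude bound `e ≤ 4` gives `r! ≥ (r/4) ^ r`; this `4` and the factor `2 ^ r` of the claim
  -- form the `8` of the hypothesis.
  have h3 : Real.exp r ≤ 4 ^ r := by
    rw [show (r : ℝ) = r * 1 by ring, Real.exp_nat_mul]
    exact pow_le_pow_left₀ (Real.exp_pos _).le (by linarith [Real.exp_one_lt_d9]) r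
  rcases Nat.eq_zero_or_pos r with rfl | hr
  · simp
  have hfac : (0 : ℝ) < r.factorial := by positivity
  have hr' : (0 : ℝ) < (r : ℝ) ^ r := by positivity
  have h4 : (r : ℝ) ^ r ≤ 4 ^ r * r.factorial := by
    rw [div_le_iff₀ hfac] at h2
    exact h2.trans (mul_le_mul_of_nonneg_right h3 hfac.le)
  have h5 : (8 * K : ℝ) ^ r ≤ (a * r : ℝ) ^ r :=
    pow_le_pow_left₀ (by positivity) (by exact_mod_cast h) r
  rw [le_div_iff₀ hfac] at h1
  refine le_of_mul_le_mul_right ?_ hr'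
  calc (K.choose r : ℝ) * 2 ^ r * (r : ℝ) ^ r
      ≤ (K.choose r : ℝ) * 2 ^ r * (4 ^ r * r.factorial) := by gcongr
    _ = (K.choose r * r.factorial) * 8 ^ r := by
        rw [show (8 : ℝ) = 2 * 4 by norm_num, mul_pow]; ring
    _ ≤ (K : ℝ) ^ r * 8 ^ r := by gcongr
    _ = (8 * K : ℝ) ^ r := by rw [mul_pow]; ring
    _ ≤ _ := h5
    _ = (a : ℝ) ^ r * (r : ℝ) ^ r := by rw [mul_pow]

-- One sample contains both vertices with probability at most `q⁻²`, so `r` hits among `n ^ 5`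
-- samples have probability at most `choose (n ^ 5) r * q ^ (-2r) ≤ 2 ^ (-r)`. The factor `4 * n ^
-- 2` leaves room for a union bound over pairs.
open Finset in
theorem card_bad_pair_le {n q : ℕ} [NeZero q] (hn : 4 ≤ n) (hqn : q ^ 2 ≤ n) {u v : Fin n}
    (huv : u ≠ v) :
    4 * n ^ 2 * #{t : Fin (n ^ 5) → Fin n → Fin q |
      8 * n ^ 5 / q ^ 2 + 1 ≤ #{s | t s ∈ ({h | h u = 0 ∧ h v = 0} : Finset (Fin n → Fin q))}} ≤
      (q ^ n) ^ (n ^ 5) := by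
  set A : Finset (Fin n → Fin q) := {h | h u = 0 ∧ h v = 0} with hA
  set r := 8 * n ^ 5 / q ^ 2 + 1 with hr
  have hq : 0 < q := Nat.pos_of_ne_zero (NeZero.ne q)
  have hq2 : 0 < q ^ 2 := by positivity
  have hrK : 8 * n ^ 5 ≤ q ^ 2 * r := by
    have := Nat.lt_mul_div_succ (8 * n ^ 5) hq2
    exact this.le
  -- Here `q ^ 2 ≤ n` is needed: the expected number of hits must be large for concentration within
  -- a constant factor.
  have hbig : 2 * n + 2 ≤ r := by
    have h1 : 8 * n ^ 4 ≤ 8 * n ^ 5 / q ^ 2 := by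
      rw [Nat.le_div_iff_mul_le hq2]
      calc 8 * n ^ 4 * q ^ 2 ≤ 8 * n ^ 4 * n := Nat.mul_le_mul_left _ hqn
        _ = 8 * n ^ 5 := by ring
    have h2 : n ≤ n ^ 4 := Nat.le_self_pow (by norm_num) n
    omega
  have hpow : 4 * n ^ 2 ≤ 2 ^ r := by
    have h1 : n < 2 ^ n := Nat.lt_two_pow_self
    calc 4 * n ^ 2 ≤ 4 * (2 ^ n) ^ 2 := by gcongr
      _ = 2 ^ (2 * n + 2) := by ring
      _ ≤ 2 ^ r := Nat.pow_le_pow_right (by norm_num) hbig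
  have hcount := card_filter_le_card_hits (n ^ 5) r A
  rw [Fintype.card_fun, Fintype.card_fin, Fintype.card_fin] at hcount
  have hch : (n ^ 5).choose r * 2 ^ r ≤ (q ^ 2) ^ r := by
    exact_mod_cast choose_mul_pow_le hrK
  have hAq : #A * q ^ 2 ≤ q ^ n := card_both_le huv
  rcases lt_or_ge (n ^ 5) r with hlt | hle
  · rw [Nat.choose_eq_zero_of_lt hlt, zero_mul, Nat.le_zero] at hcount
    rw [hcount]; simp
  · calc _ ≤ 2 ^ r * ((n ^ 5).choose r * (#A ^ r * (q ^ n) ^ (n ^ 5 - r))) :=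
        Nat.mul_le_mul hpow hcount
      _ = ((n ^ 5).choose r * 2 ^ r) * (#A ^ r * (q ^ n) ^ (n ^ 5 - r)) := by ring
      _ ≤ (q ^ 2) ^ r * (#A ^ r * (q ^ n) ^ (n ^ 5 - r)) := Nat.mul_le_mul_right _ hch
      _ = (#A * q ^ 2) ^ r * (q ^ n) ^ (n ^ 5 - r) := by rw [mul_pow]; ring
      _ ≤ (q ^ n) ^ r * (q ^ n) ^ (n ^ 5 - r) :=
        Nat.mul_le_mul_right _ (Nat.pow_le_pow_left hAq _)
      _ = (q ^ n) ^ (n ^ 5) := by rw [← pow_add, Nat.add_sub_cancel' hle]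

-- The failure probability is at most `choose (n ^ 5) n * n ^ (-6n) ≤ n ^ (-n)`, small enough for a
-- union bound over all `2 ^ n` vertex sets.
open Finset in
theorem card_bad_miss_le {n q : ℕ} [NeZero q] (hn : 4 ≤ n) {N : Finset (Fin n)}
    (hN : n ^ 6 ≤ 2 ^ (#N / q)) :
    4 * 2 ^ n * #{t : Fin (n ^ 5) → Fin n → Fin q |
      n ≤ #{s | t s ∈ ({h | ∀ v ∈ N, h v ≠ 0} : Finset (Fin n → Fin q))}} ≤
      (q ^ n) ^ (n ^ 5) := by
  set A : Finset (Fin n → Fin q) := {h | ∀ v ∈ N, h v ≠ 0} with hA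
  have hq : 0 < q := Nat.pos_of_ne_zero (NeZero.ne q)
  have hcount := card_filter_le_card_hits (n ^ 5) n A
  rw [Fintype.card_fun, Fintype.card_fin, Fintype.card_fin] at hcount
  have hch : (n ^ 5).choose n ≤ (n ^ 5) ^ n := Nat.choose_le_pow _ _
  have hAq : #A * n ^ 6 ≤ q ^ n :=
    (Nat.mul_le_mul_left _ hN).trans (card_missing_le hq N)
  have hpow : 4 * 2 ^ n ≤ n ^ n := by
    calc 4 * 2 ^ n ≤ 2 ^ n * 2 ^ n :=
          Nat.mul_le_mul_right _ (by
            calc 4 = 2 ^ 2 := by norm_num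
              _ ≤ 2 ^ n := Nat.pow_le_pow_right (by norm_num) (by omega))
      _ = 4 ^ n := by rw [← mul_pow]; norm_num
      _ ≤ n ^ n := Nat.pow_le_pow_left hn _
  have hle : n ≤ n ^ 5 := Nat.le_self_pow (by norm_num) n
  calc _ ≤ n ^ n * ((n ^ 5) ^ n * (#A ^ n * (q ^ n) ^ (n ^ 5 - n))) :=
        Nat.mul_le_mul hpow (hcount.trans (Nat.mul_le_mul_right _ hch))
    _ = (#A * n ^ 6) ^ n * (q ^ n) ^ (n ^ 5 - n) := by
        rw [mul_pow, show n ^ 6 = n * n ^ 5 by ring, mul_pow]; ring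
    _ ≤ (q ^ n) ^ n * (q ^ n) ^ (n ^ 5 - n) :=
        Nat.mul_le_mul_right _ (Nat.pow_le_pow_left hAq _)
    _ = (q ^ n) ^ (n ^ 5) := by rw [← pow_add, Nat.add_sub_cancel' hle]

open Finset in
/-- There are `n ^ 5` sets such that few of them contain any given pair of vertices, and few of
them are disjoint from any given large set of vertices. -/
theorem exists_table {n q : ℕ} (hn : 4 ≤ n) (hq : 1 ≤ q) (hqn : q ^ 2 ≤ n) :
    ∃ t : Fin (n ^ 5) → Fin n → Bool,
      (∀ u v, u ≠ v → q ^ 2 * #{s | t s u = true ∧ t s v = true} ≤ 8 * n ^ 5) ∧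
      ∀ N : Finset (Fin n), n ^ 6 ≤ 2 ^ (#N / q) → #{s | ∀ v ∈ N, t s v = false} < n := by
  classical
  have : NeZero q := ⟨by omega⟩
  let P : Fin n × Fin n → Finset (Fin (n ^ 5) → Fin n → Fin q) := fun e =>
    {t | 8 * n ^ 5 / q ^ 2 + 1 ≤
      #{s | t s ∈ ({h | h e.1 = 0 ∧ h e.2 = 0} : Finset (Fin n → Fin q))}}
  let Q : Finset (Fin n) → Finset (Fin (n ^ 5) → Fin n → Fin q) := fun N =>
    {t | n ≤ #{s | t s ∈ ({h | ∀ v ∈ N, h v ≠ 0} : Finset (Fin n → Fin q))}}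
  let bad := (univ.filter fun e : Fin n × Fin n => e.1 ≠ e.2).biUnion P ∪
    (univ.filter fun N : Finset (Fin n) => n ^ 6 ≤ 2 ^ (#N / q)).biUnion Q
  have htot : Fintype.card (Fin (n ^ 5) → Fin n → Fin q) = (q ^ n) ^ (n ^ 5) := by
    simp
  have hpos : 0 < (q ^ n) ^ (n ^ 5) := by positivity
  have hP : 4 * #((univ.filter fun e : Fin n × Fin n => e.1 ≠ e.2).biUnion P) ≤
      (q ^ n) ^ (n ^ 5) := by
    have h1 : n ^ 2 * (4 * #((univ.filter fun e : Fin n × Fin n => e.1 ≠ e.2).biUnion P)) ≤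
        n ^ 2 * (q ^ n) ^ (n ^ 5) := by
      calc _ ≤ n ^ 2 * (4 * ∑ e ∈ univ.filter fun e : Fin n × Fin n => e.1 ≠ e.2, #(P e)) := by
            gcongr; exact card_biUnion_le
        _ = ∑ e ∈ univ.filter fun e : Fin n × Fin n => e.1 ≠ e.2, 4 * n ^ 2 * #(P e) := by
            rw [← mul_sum]; ring
        _ ≤ ∑ e ∈ univ.filter fun e : Fin n × Fin n => e.1 ≠ e.2, (q ^ n) ^ (n ^ 5) :=
            sum_le_sum fun e he => card_bad_pair_le hn hqn (mem_filter.1 he).2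
        _ ≤ ∑ e : Fin n × Fin n, (q ^ n) ^ (n ^ 5) :=
            sum_le_sum_of_subset (subset_univ _)
        _ = _ := by simp [sq]
    exact Nat.le_of_mul_le_mul_left h1 (by positivity)
  have hQ : 4 * #((univ.filter fun N : Finset (Fin n) => n ^ 6 ≤ 2 ^ (#N / q)).biUnion Q) ≤
      (q ^ n) ^ (n ^ 5) := by
    have h1 : 2 ^ n * (4 * #((univ.filter fun N : Finset (Fin n) =>
        n ^ 6 ≤ 2 ^ (#N / q)).biUnion Q)) ≤ 2 ^ n * (q ^ n) ^ (n ^ 5) := by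
      calc _ ≤ 2 ^ n * (4 * ∑ N ∈ univ.filter fun N : Finset (Fin n) =>
              n ^ 6 ≤ 2 ^ (#N / q), #(Q N)) := by
            gcongr; exact card_biUnion_le
        _ = ∑ N ∈ univ.filter fun N : Finset (Fin n) => n ^ 6 ≤ 2 ^ (#N / q),
              4 * 2 ^ n * #(Q N) := by
            rw [← mul_sum]; ring
        _ ≤ ∑ N ∈ univ.filter fun N : Finset (Fin n) => n ^ 6 ≤ 2 ^ (#N / q),
              (q ^ n) ^ (n ^ 5) :=
            sum_le_sum fun N hN => card_bad_miss_le hn (mem_filter.1 hN).2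
        _ ≤ ∑ N : Finset (Fin n), (q ^ n) ^ (n ^ 5) :=
            sum_le_sum_of_subset (subset_univ _)
        _ = _ := by simp
    exact Nat.le_of_mul_le_mul_left h1 (by positivity)
  -- Each of the two kinds of defect spoils at most a quarter of all tuples.
  have hbad : #bad < #(univ : Finset (Fin (n ^ 5) → Fin n → Fin q)) := by
    rw [card_univ, htot]
    have := card_union_le ((univ.filter fun e : Fin n × Fin n => e.1 ≠ e.2).biUnion P)
      ((univ.filter fun N : Finset (Fin n) => n ^ 6 ≤ 2 ^ (#N / q)).biUnion Q)
    change #(_ ∪ _) < _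
    omega
  obtain ⟨t, -, ht⟩ := exists_mem_notMem_of_card_lt_card hbad
  simp only [bad, mem_union, mem_biUnion, mem_filter, mem_univ, true_and, not_or, not_exists,
    not_and, P, Q, not_le, Prod.forall] at ht
  refine ⟨fun s v => decide (t s v = 0), fun u v huv => ?_, fun N hN => ?_⟩
  · have h1 := ht.1 u v huv
    simp only [decide_eq_true_eq]
    have h2 : #{s | t s u = 0 ∧ t s v = 0} ≤ 8 * n ^ 5 / q ^ 2 := by omega
    calc _ ≤ q ^ 2 * (8 * n ^ 5 / q ^ 2) := Nat.mul_le_mul_left _ h2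
      _ ≤ _ := Nat.mul_div_le _ _
  · simpa using ht.2 N hN

theorem tableBit_le_one (n c s v : ℕ) : tableBit n c s v ≤ 1 :=
  Nat.le_of_lt_succ (Nat.mod_lt _ two_pos)

theorem exists_code (m : ℕ) (b : ℕ → Bool) :
    ∃ c < 2 ^ m, ∀ i < m, c / 2 ^ i % 2 = (b i).toNat := by
  refine ⟨Nat.ofBits fun i : Fin m => b i, Nat.ofBits_lt_two_pow _, fun i hi => ?_⟩
  rw [← Nat.toNat_testBit, Nat.testBit_ofBits_lt _ _ hi]

theorem exists_tableBit_eq {n K : ℕ} (t : Fin K → Fin n → Bool) :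
    ∃ c < 2 ^ (K * n), ∀ (s : Fin K) (v : Fin n), tableBit n c s v = (t s v).toNat := by
  obtain ⟨c, hc, h⟩ := exists_code (K * n) fun i =>
    if hi : i < K * n then t ⟨i / n, Nat.div_lt_of_lt_mul (by rwa [mul_comm] at hi)⟩
      ⟨i % n, Nat.mod_lt _ (Nat.pos_of_ne_zero fun h0 => by simp [h0] at hi)⟩ else false
  refine ⟨c, hc, fun s v => ?_⟩
  have hlt : (s : ℕ) * n + v < K * n := by
    have := s.2; have := v.2
    calc (s : ℕ) * n + v < (s + 1) * n := by rw [add_mul]; omega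
      _ ≤ K * n := Nat.mul_le_mul_right _ s.2
  have hn : 0 < n := v.pos
  have hdiv : ((s : ℕ) * n + v) / n = s := by
    rw [mul_comm, Nat.mul_add_div hn, Nat.div_eq_of_lt v.2, add_zero]
  have hmod : ((s : ℕ) * n + v) % n = v := by
    rw [mul_comm, Nat.mul_add_mod, Nat.mod_eq_of_lt v.2]
  rw [tableBit, h _ hlt]
  simp only [hlt, dite_true, hdiv, hmod]

open Finset in
theorem exists_defects_eq_zero {n q : ℕ} (hn : 4 ≤ n) (hq : 1 ≤ q) (hqn : q ^ 2 ≤ n) :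
    ∃ c ≤ 2 ^ (n ^ 6), pairDefects n q c + missDefects n q c ≤ 0 := by
  obtain ⟨t, ht1, ht2⟩ := exists_table hn hq hqn
  obtain ⟨c, hc, hct⟩ := exists_tableBit_eq t
  refine ⟨c, by rw [show n ^ 6 = n ^ 5 * n by ring]; exact hc.le, ?_⟩
  have h1 : pairDefects n q c = 0 := by
    refine sum_eq_zero fun u hu => sum_eq_zero fun v hv => ?_
    rw [mem_range] at hu hv
    split_ifs with huv h
    · rfl
    · refine absurd (ht1 ⟨u, hu⟩ ⟨v, hv⟩ (by simpa using huv)) (not_le.2 ?_)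
      refine h.trans_eq ?_
      congr 1
      rw [← Fin.sum_univ_eq_sum_range (fun s => tableBit n c s u * tableBit n c s v),
        card_filter]
      refine sum_congr rfl fun s _ => ?_
      have e1 := hct s ⟨u, hu⟩
      have e2 := hct s ⟨v, hv⟩
      simp only at e1 e2
      rw [e1, e2]
      cases t s ⟨u, hu⟩ <;> cases t s ⟨v, hv⟩ <;> rfl
    · rfl
  have h2 : missDefects n q c = 0 := by
    refine sum_eq_zero fun N hN => ?_
    split_ifs with h3 h4
    -- The number `N` encodes a vertex set: `tableBit n N 0 v` is its bit at `v`.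
    · let N' : Finset (Fin n) := {v | tableBit n N 0 v = 1}
      have hcard : ∑ v ∈ range n, tableBit n N 0 v = #N' := by
        rw [← Fin.sum_univ_eq_sum_range (fun v => tableBit n N 0 v), card_filter]
        refine sum_congr rfl fun v _ => ?_
        have := tableBit_le_one n N 0 v
        split_ifs <;> omega
      rw [hcard] at h3
      refine absurd (ht2 N' h3) (not_lt.2 (h4.trans_eq ?_))
      rw [← Fin.sum_univ_eq_sum_range (fun s => if ∑ v ∈ range n,
        tableBit n N 0 v * tableBit n c s v = 0 then 1 else 0), card_filter]
      refine sum_congr rfl fun s _ => if_congr ?_ rfl rfl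
      rw [← Fin.sum_univ_eq_sum_range (fun v => tableBit n N 0 v * tableBit n c s v),
        sum_eq_zero_iff]
      simp only [mem_univ, true_implies, hct, N', mem_filter, true_and]
      refine forall_congr' fun v => ?_
      have := tableBit_le_one n N 0 v
      rcases Nat.le_one_iff_eq_zero_or_eq_one.1 this with h | h <;> simp [h]
    · rfl
    · rfl
  rw [h1, h2]

/-- The search has default value `0`, so a code without defects must be known to exist below `2 ^ (n
^ 6)`; a table has `n ^ 5 * n` bits. -/
theorem tableCode_spec {n q : ℕ} (hn : 4 ≤ n) (hq : 1 ≤ q) (hqn : q ^ 2 ≤ n) :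
    pairDefects n q (tableCode n q) = 0 ∧ missDefects n q (tableCode n q) = 0 := by
  obtain ⟨c, hc, h⟩ := exists_defects_eq_zero hn hq hqn
  have := Nat.findGreatest_spec (P := fun c => pairDefects n q c + missDefects n q c ≤ 0) hc h
  change pairDefects n q (tableCode n q) + missDefects n q (tableCode n q) ≤ 0 at this
  omega

theorem member_le_one (n₀ n q s v : ℕ) : member n₀ n q s v ≤ 1 := by
  unfold member
  split_ifs
  exacts [le_rfl, tableBit_le_one _ _ _ _]

open Finset in
theorem sum_member_mul_member_le {n₀ n q u v : ℕ} (hn₀ : n₀ ≤ n) (hn : 4 ≤ n) (hq : 1 ≤ q)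
    (hqn : q ^ 2 ≤ n) (hu : u < n) (hv : v < n) (huv : u ≠ v) :
    q ^ 2 * ∑ s ∈ range (n ^ 5), member n₀ n q s u * member n₀ n q s v ≤ 8 * n ^ 5 := by
  have h := (tableCode_spec hn hq hqn).1
  unfold pairDefects at h
  rw [sum_eq_zero_iff] at h
  have h1 := h u (mem_range.2 hu)
  rw [sum_eq_zero_iff] at h1
  have h2 := h1 v (mem_range.2 hv)
  rw [if_neg huv] at h2
  simp only [member, if_neg hn₀.not_gt]
  by_contra hcon
  rw [if_pos (not_le.1 hcon)] at h2
  exact one_ne_zero h2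

open Finset in
theorem sum_disjoint_lt {n₀ n q : ℕ} (hn₀ : n₀ ≤ n) (hn : 4 ≤ n) (hq : 1 ≤ q)
    (hqn : q ^ 2 ≤ n) {l : List ℕ} (hl : l.Nodup) (hln : ∀ v ∈ l, v < n)
    (hlarge : n ^ 6 ≤ 2 ^ (l.length / q)) :
    ∑ s ∈ range (n ^ 5), (if (l.map (member n₀ n q s)).sum = 0 then 1 else 0) < n := by
  have h := (tableCode_spec hn hq hqn).2
  unfold missDefects at h
  rw [sum_eq_zero_iff] at h
  obtain ⟨N, hN, hbit⟩ := exists_code n fun v => decide (v ∈ l)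
  have hbit' : ∀ v ∈ range n, tableBit n N 0 v = if v ∈ l then 1 else 0 := by
    intro v hv
    rw [tableBit, zero_mul, zero_add, hbit v (mem_range.1 hv)]
    by_cases h : v ∈ l <;> simp [h]
  have hfilter : {v ∈ range n | v ∈ l} = l.toFinset := by
    ext v; simp only [mem_filter, mem_range, List.mem_toFinset]
    exact ⟨And.right, fun h => ⟨hln v h, h⟩⟩
  have hcard : ∑ v ∈ range n, tableBit n N 0 v = l.length := by
    rw [sum_congr rfl hbit', ← card_filter, hfilter, List.toFinset_card_of_nodup hl]
  have hsum : ∀ s, ∑ v ∈ range n, tableBit n N 0 v * tableBit n (tableCode n q) s v =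
      (l.map (member n₀ n q s)).sum := by
    intro s
    rw [show member n₀ n q s = tableBit n (tableCode n q) s from
      funext fun v => if_neg hn₀.not_gt]
    rw [← List.sum_toFinset _ hl, ← hfilter, sum_filter]
    refine sum_congr rfl fun v hv => ?_
    rw [hbit' v hv]
    split_ifs <;> simp
  have h1 := h N (mem_range.2 hN)
  rw [hcard, if_pos hlarge] at h1
  by_contra hcon
  rw [if_pos] at h1
  · exact one_ne_zero h1
  · refine (not_lt.1 hcon).trans_eq (sum_congr rfl fun s _ => ?_)
    rw [hsum]

/-! ### Choosing a set from the table -/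

/-- The cost that vertex `v` with neighbours `N` charges for the set with index `s`: the number of
its edges inside the set, and a penalty if `N` is large and disjoint from the set. -/
def cost (n₀ n q s v : ℕ) (N : List ℕ) : ℕ :=
  member n₀ n q s v * (N.map fun u => member n₀ n q s u).sum +
    if n ^ 6 ≤ 2 ^ (N.length / q) then
      (if (N.map fun u => member n₀ n q s u).sum = 0 then n ^ 3 else 0)
    else 0

/-- The total cost of the `w` sets in block `y`. -/
def blockCost (n₀ n q w y v : ℕ) (N : List ℕ) : ℕ :=
  ∑ i ∈ Finset.range w, cost n₀ n q (y * w + i) v N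

/-- An index `j < n` such that `g j` is at most the average of `g 0, …, g (n - 1)`. -/
def select (n : ℕ) (g : ℕ → ℕ) : ℕ :=
  Nat.findGreatest (fun j => n * g j ≤ ∑ i ∈ Finset.range n, g i) (n - 1)

/-- The index that is found by choosing `t` of its digits in base `n` one after the other, such that
the average of `g` over the indices that start with these digits does not increase. -/
def chosenPrefix (n : ℕ) (g : ℕ → ℕ) (t : ℕ) : ℕ :=
  Nat.rec 0 (fun t p => p * n + select n fun j =>
    ∑ i ∈ Finset.range (n ^ (4 - t)), g ((p * n + j) * n ^ (4 - t) + i)) t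

@[fun_prop]
theorem primrec_blockCost {α : Type*} [Primcodable α] (n₀ : ℕ) {n q w y v : α → ℕ}
    {N : α → List ℕ} (hn : Primrec n) (hq : Primrec q) (hw : Primrec w) (hy : Primrec y)
    (hv : Primrec v) (hN : Primrec N) :
    Primrec fun a => blockCost n₀ (n a) (q a) (w a) (y a) (v a) (N a) := by
  unfold blockCost cost
  fun_prop

@[fun_prop]
theorem primrec_select {α : Type*} [Primcodable α] {n : α → ℕ} {g : α → ℕ → ℕ}
    (hn : Primrec n) (hg : Primrec fun p : α × ℕ => g p.1 p.2) :
    Primrec fun a => select (n a) (g a) := by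
  unfold select
  have : Primrec fun p : (α × ℕ) × ℕ => g p.1.1 p.2 :=
    hg.comp ((Primrec.fst.comp Primrec.fst).pair Primrec.snd)
  fun_prop

theorem select_lt {n : ℕ} (hn : 0 < n) (g : ℕ → ℕ) : select n g < n :=
  (Nat.findGreatest_le _).trans_lt (Nat.sub_lt hn one_pos)

theorem mul_select_le {n : ℕ} (hn : 0 < n) (g : ℕ → ℕ) :
    n * g (select n g) ≤ ∑ i ∈ Finset.range n, g i := by
  obtain ⟨j, hj, h⟩ : ∃ j ∈ Finset.range n, n * g j ≤ ∑ i ∈ Finset.range n, g i := by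
    by_contra! h
    have := Finset.sum_lt_sum_of_nonempty (Finset.nonempty_range_iff.2 hn.ne') h
    simp [← Finset.mul_sum] at this
  exact Nat.findGreatest_spec (P := fun j => n * g j ≤ ∑ i ∈ Finset.range n, g i)
    (Nat.le_sub_one_of_lt (Finset.mem_range.1 hj)) h

/-- Only the `n` values that were communicated influence the choice; this is why all participants
choose the same digit. -/
theorem select_congr {n : ℕ} {g h : ℕ → ℕ} (H : ∀ j < n, g j = h j) (hn : 0 < n) :
    select n g = select n h := by
  have hsum : ∑ i ∈ Finset.range n, g i = ∑ i ∈ Finset.range n, h i :=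
    Finset.sum_congr rfl fun i hi => H i (Finset.mem_range.1 hi)
  unfold select
  rw [hsum]
  generalize ∑ i ∈ Finset.range n, h i = a
  have : ∀ k < n, Nat.findGreatest (fun j => n * g j ≤ a) k =
      Nat.findGreatest (fun j => n * h j ≤ a) k := by
    intro k hk
    induction k with
    | zero => rfl
    | succ k ih => simp only [Nat.findGreatest, H _ hk, ih (by omega)]
  exact this _ (Nat.sub_lt hn one_pos)

theorem sum_range_mul (g : ℕ → ℕ) (n w : ℕ) :
    ∑ i ∈ Finset.range (n * w), g i =
      ∑ j ∈ Finset.range n, ∑ i ∈ Finset.range w, g (j * w + i) := by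
  induction n with
  | zero => simp
  | succ n ih => rw [add_mul, one_mul, Finset.sum_range_add, ih, Finset.sum_range_succ]

theorem chosenPrefix_succ (n : ℕ) (g : ℕ → ℕ) (t : ℕ) :
    chosenPrefix n g (t + 1) = chosenPrefix n g t * n + select n fun j =>
      ∑ i ∈ Finset.range (n ^ (4 - t)), g ((chosenPrefix n g t * n + j) * n ^ (4 - t) + i) := rfl

/-- Conditional expectations without division: the average over the block that remains after `t`
digits never exceeds the average over the table. -/
theorem pow_mul_sum_chosenPrefix_le {n : ℕ} (hn : 0 < n) (g : ℕ → ℕ) {t : ℕ} (ht : t ≤ 5) :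
    n ^ t * ∑ i ∈ Finset.range (n ^ (5 - t)), g (chosenPrefix n g t * n ^ (5 - t) + i) ≤
      ∑ s ∈ Finset.range (n ^ 5), g s := by
  induction t with
  | zero => simp [chosenPrefix]
  | succ t ih =>
    refine le_trans ?_ (ih (by omega))
    have h5 : n ^ (5 - t) = n * n ^ (4 - t) := by
      rw [← pow_succ', show 4 - t + 1 = 5 - t by omega]
    have h4 : 5 - (t + 1) = 4 - t := by omega
    rw [h5, h4, sum_range_mul, pow_succ, mul_assoc]
    refine Nat.mul_le_mul_left _ ?_
    have := mul_select_le hn fun j =>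
      ∑ i ∈ Finset.range (n ^ (4 - t)), g ((chosenPrefix n g t * n + j) * n ^ (4 - t) + i)
    rw [← chosenPrefix_succ] at this
    refine this.trans_eq (Finset.sum_congr rfl fun j _ => Finset.sum_congr rfl fun i _ => ?_)
    congr 1; ring

theorem pow_mul_chosenPrefix_le {n : ℕ} (hn : 0 < n) (g : ℕ → ℕ) :
    n ^ 5 * g (chosenPrefix n g 5) ≤ ∑ s ∈ Finset.range (n ^ 5), g s := by
  simpa using pow_mul_sum_chosenPrefix_le hn g le_rfl

/-! ### The cost of the table sets in the input graph -/

section Graph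

variable {n : ℕ} (G : SimpleGraph (Fin n)) [DecidableRel G.Adj]

theorem sum_map_neighborList (v : Fin n) (h : ℕ → ℕ) :
    ((neighborList G v).map h).sum = ∑ u : Fin n, if G.Adj v u then h u else 0 := by
  rw [neighborList, List.map_map, ← Finset.sum_filter, ← List.sum_toFinset]
  · refine Finset.sum_congr ?_ fun _ _ => rfl
    ext u; simp
  · exact (List.nodup_finRange n).filter _

theorem length_neighborList (v : Fin n) : (neighborList G v).length = G.degree v := by
  rw [neighborList, List.length_map, ← SimpleGraph.card_neighborFinset_eq_degree,
    ← List.toFinset_card_of_nodup ((List.nodup_finRange n).filter _)]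
  congr 1; ext u; simp

theorem nodup_neighborList (v : Fin n) : (neighborList G v).Nodup :=
  ((List.nodup_finRange n).filter _).map Fin.val_injective

theorem lt_of_mem_neighborList {v : Fin n} {u : ℕ} (h : u ∈ neighborList G v) : u < n := by
  obtain ⟨w, -, rfl⟩ := List.mem_map.1 h
  exact w.2

/-- The total cost of the set with index `s`. -/
def graphCost (n₀ q s : ℕ) : ℕ := ∑ v : Fin n, cost n₀ n q s v (neighborList G v)

-- Exchange the sums over indices and vertices. Each of the `2 * m` ordered adjacent pairs
-- contributes at most `8 * n ^ 5 / q ^ 2`, and each vertex pays the penalty `n ^ 3` for fewer than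
-- `n` indices.
open Finset in
theorem mul_sum_graphCost_le {n₀ q : ℕ} (hn₀ : n₀ ≤ n) (hn : 4 ≤ n) (hq : 1 ≤ q)
    (hqn : q ^ 2 ≤ n) :
    q ^ 2 * ∑ s ∈ range (n ^ 5), graphCost G n₀ q s ≤
      n ^ 5 * (16 * #G.edgeFinset + q ^ 2) := by
  have h1 : ∀ v : Fin n, q ^ 2 * ∑ s ∈ range (n ^ 5),
      member n₀ n q s v * ((neighborList G v).map fun u => member n₀ n q s u).sum ≤
        8 * n ^ 5 * G.degree v := by
    intro v
    simp only [sum_map_neighborList, mul_sum, mul_ite, mul_zero]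
    rw [sum_comm, ← G.card_neighborFinset_eq_degree, card_eq_sum_ones, mul_sum,
      G.neighborFinset_eq_filter, sum_filter]
    refine sum_le_sum fun u _ => ?_
    split_ifs with hvu
    · rw [← mul_sum, mul_one]
      exact sum_member_mul_member_le hn₀ hn hq hqn v.2 u.2 (by
        simpa [Fin.ext_iff] using hvu.ne)
    · simp
  have h2 : ∀ v : Fin n, ∑ s ∈ range (n ^ 5),
      (if n ^ 6 ≤ 2 ^ ((neighborList G v).length / q) then
        (if ((neighborList G v).map fun u => member n₀ n q s u).sum = 0 then n ^ 3 else 0)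
        else 0) ≤ n ^ 4 := by
    intro v
    split_ifs with hlarge
    · have := sum_disjoint_lt hn₀ hn hq hqn (nodup_neighborList G v)
        (fun u hu => lt_of_mem_neighborList G hu) hlarge
      calc _ = n ^ 3 * ∑ s ∈ range (n ^ 5),
            (if ((neighborList G v).map (member n₀ n q s)).sum = 0 then 1 else 0) := by
            rw [mul_sum]; refine sum_congr rfl fun s _ => ?_; simp
        _ ≤ n ^ 3 * n := Nat.mul_le_mul_left _ this.le
        _ = n ^ 4 := by ring
    · simp
  unfold graphCost cost
  rw [sum_comm]
  simp only [sum_add_distrib, mul_add]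
  calc _ ≤ ∑ v : Fin n, 8 * n ^ 5 * G.degree v + q ^ 2 * ∑ v : Fin n, n ^ 4 := by
        rw [mul_sum]
        exact add_le_add (sum_le_sum fun v _ => h1 v)
          (Nat.mul_le_mul_left _ (sum_le_sum fun v _ => h2 v))
    _ = _ := by
        rw [← mul_sum, G.sum_degrees_eq_twice_card_edges]
        simp; ring

-- Drop the penalties: what remains is the degree sum of the induced subgraph.
open Finset in
theorem two_mul_ncard_induce_le (n₀ q s : ℕ) (Z : Finset (Fin n))
    (hZ : ∀ v, v ∈ Z ↔ member n₀ n q s v = 1) :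
    2 * (G.induce (Z : Set (Fin n))).edgeSet.ncard ≤ graphCost G n₀ q s := by
  classical
  have h1 : (G.induce (Z : Set (Fin n))).edgeSet.ncard =
      #(G.induce (Z : Set (Fin n))).edgeFinset := by
    rw [← SimpleGraph.coe_edgeFinset, Set.ncard_coe_finset]
  rw [h1, ← SimpleGraph.sum_degrees_eq_twice_card_edges]
  have h2 : ∀ v : (Z : Set (Fin n)), (G.induce (Z : Set (Fin n))).degree v =
      ∑ u ∈ Z, if G.Adj v u then 1 else 0 := by
    intro v
    rw [← SimpleGraph.card_neighborFinset_eq_degree, SimpleGraph.neighborFinset_eq_filter,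
      card_filter]
    exact (sum_coe_sort Z fun u => if G.Adj v u then 1 else 0)
  simp only [h2]
  refine (sum_coe_sort Z fun v => ∑ u ∈ Z, if G.Adj v u then 1 else 0).trans_le ?_
  unfold graphCost
  refine le_trans ?_ (sum_le_sum_of_subset (subset_univ Z))
  refine sum_le_sum fun v hv => ?_
  rw [cost, (hZ v).1 hv, one_mul, sum_map_neighborList]
  refine le_trans ?_ (Nat.le_add_right _ _)
  refine le_trans (sum_le_sum fun u hu => ?_) (sum_le_sum_of_subset (subset_univ Z))
  rw [(hZ u).1 hu]

/-- The set with the chosen index has few edges and meets all large neighbourhoods. -/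
theorem chosen_set_spec {n₀ q : ℕ} (hn₀ : n₀ ≤ n) (hn : 17 ≤ n) (hq : 1 ≤ q)
    (hqn : q ^ 2 ≤ n) (hqm : q ^ 2 ≤ G.edgeFinset.card) (Z : Finset (Fin n))
    (hZ : ∀ v, v ∈ Z ↔ member n₀ n q (chosenPrefix n (graphCost G n₀ q) 5) v = 1) :
    2 * q ^ 2 * (G.induce (Z : Set (Fin n))).edgeSet.ncard ≤ 17 * G.edgeFinset.card ∧
    ∀ v, n ^ 6 ≤ 2 ^ (G.degree v / q) → ∃ u ∈ Z, G.Adj v u := by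
  set s := chosenPrefix n (graphCost G n₀ q) 5 with hs
  have hpos : 0 < n := by omega
  have h1 : q ^ 2 * graphCost G n₀ q s ≤ 17 * G.edgeFinset.card := by
    have h2 := pow_mul_chosenPrefix_le hpos (graphCost G n₀ q)
    have h3 := mul_sum_graphCost_le G hn₀ (by omega) hq hqn
    refine Nat.le_of_mul_le_mul_left ?_ (pow_pos hpos 5)
    calc n ^ 5 * (q ^ 2 * graphCost G n₀ q s) = q ^ 2 * (n ^ 5 * graphCost G n₀ q s) := by ring
      _ ≤ q ^ 2 * ∑ s ∈ Finset.range (n ^ 5), graphCost G n₀ q s := Nat.mul_le_mul_left _ h2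
      _ ≤ _ := h3
      -- The hypothesis `q ^ 2 ≤ m` absorbs the penalties into one more `m`.
      _ ≤ n ^ 5 * (17 * G.edgeFinset.card) := Nat.mul_le_mul_left _ (by omega)
  refine ⟨?_, fun v hv => ?_⟩
  · have := two_mul_ncard_induce_le G n₀ q s Z hZ
    calc _ = q ^ 2 * (2 * (G.induce (Z : Set (Fin n))).edgeSet.ncard) := by ring
      _ ≤ _ := (Nat.mul_le_mul_left _ this).trans h1
  · by_contra! hcon
    have h0 : ((neighborList G v).map fun u => member n₀ n q s u).sum = 0 := by
      rw [sum_map_neighborList]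
      refine Finset.sum_eq_zero fun u _ => ?_
      split_ifs with hvu
      · have h4 := member_le_one n₀ n q s u
        have h5 : member n₀ n q s u ≠ 1 := fun h => hcon u ((hZ u).2 h) hvu
        omega
      · rfl
    have h2 : n ^ 3 ≤ graphCost G n₀ q s := by
      refine le_trans ?_ (Finset.single_le_sum (f := fun v : Fin n =>
        cost n₀ n q s v (neighborList G v)) (fun _ _ => Nat.zero_le _) (Finset.mem_univ v))
      simp only [cost]
      rw [length_neighborList, if_pos hv, if_pos h0]
      exact Nat.le_add_left _ _
    have h3 : 2 * G.edgeFinset.card ≤ n * n := by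
      rw [← G.sum_degrees_eq_twice_card_edges]
      calc _ ≤ ∑ v : Fin n, n := Finset.sum_le_sum fun v _ => by
            simpa using (G.degree_lt_card_verts v).le
        _ = n * n := by simp
    have h4 : graphCost G n₀ q s ≤ q ^ 2 * graphCost G n₀ q s :=
      Nat.le_mul_of_pos_left _ (by positivity)
    -- A single penalty would give `n ^ 3 ≤ 17 * m ≤ 17 * n ^ 2 / 2`, which fails from `n = 17` on.
    have h5 : 17 * (n * n) ≤ n ^ 3 := by
      calc 17 * (n * n) ≤ n * (n * n) := Nat.mul_le_mul_right _ hn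
        _ = n ^ 3 := by ring
    have h6 : 0 < n * n := by positivity
    omega

end Graph

/-! ### Sizes of numbers -/

theorem size_le_of_lt_pow {n x b : ℕ} (h : x < n ^ b) : Nat.size x ≤ b * (Nat.log 2 n + 1) := by
  rw [Nat.size_le, mul_comm, pow_mul]
  exact h.trans_le (Nat.pow_le_pow_left (Nat.lt_pow_succ_log_self one_lt_two n).le b)

theorem cost_le {n₀ n q s v : ℕ} {N : List ℕ} (hN : N.length ≤ n) :
    cost n₀ n q s v N ≤ 2 * n ^ 3 := by
  have h1 : (N.map fun u => member n₀ n q s u).sum ≤ n := by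
    refine (List.sum_le_card_nsmul _ 1 ?_).trans (by simpa using hN)
    intro x hx
    obtain ⟨u, -, rfl⟩ := List.mem_map.1 hx
    exact member_le_one _ _ _ _ _
  have h2 : n ≤ n ^ 3 := Nat.le_self_pow (by norm_num) n
  have h3 := Nat.mul_le_mul (member_le_one n₀ n q s v) h1
  unfold cost
  split_ifs <;> omega

theorem blockCost_le {n₀ n q t y v : ℕ} {N : List ℕ} (hN : N.length ≤ n) (hn : 1 ≤ n) :
    blockCost n₀ n q (n ^ (4 - t)) y v N ≤ 2 * n ^ 7 := by
  calc _ ≤ ∑ i ∈ Finset.range (n ^ (4 - t)), 2 * n ^ 3 :=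
        Finset.sum_le_sum fun i _ => cost_le hN
    _ = n ^ (4 - t) * (2 * n ^ 3) := by simp
    _ ≤ n ^ 4 * (2 * n ^ 3) := Nat.mul_le_mul_right _ (Nat.pow_le_pow_right hn (by omega))
    _ = 2 * n ^ 7 := by ring

/-! ### The algorithm for the Congested Clique -/

/-- The first `t` digits of the chosen index, as a node with transcript `T` knows them. -/
def cliquePrefix (n : ℕ) (T : List (List ℕ)) (t : ℕ) : ℕ :=
  Nat.rec 0 (fun t p => p * n + select n fun j => (T.getD (2 * t + 1) []).getD j 0) t

@[fun_prop]
theorem primrec_cliquePrefix {α : Type*} [Primcodable α] {n t : α → ℕ} {T : α → List (List ℕ)}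
    (hn : Primrec n) (hT : Primrec T) (ht : Primrec t) :
    Primrec fun a => cliquePrefix (n a) (T a) (t a) := by
  refine Primrec.nat_rec' ht (Primrec.const 0) (Primrec.to₂ (f := fun p : α × ℕ × ℕ =>
    p.2.2 * n p.1 + select (n p.1) fun j => ((T p.1).getD (2 * p.2.1 + 1) []).getD j 0) ?_)
  fun_prop

/-- In even rounds every node sends its cost of block `u` to node `u`, and in odd rounds node `u`
sends the total cost of block `u` to all nodes. -/
def cliqueSend (n₀ : ℕ) (x : CliqueView) (u : ℕ) : ℕ :=
  if x.2.2.2.2.length % 2 = 0 then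
    blockCost n₀ x.1 x.2.1 (x.1 ^ (4 - x.2.2.2.2.length / 2))
      (cliquePrefix x.1 x.2.2.2.2 (x.2.2.2.2.length / 2) * x.1 + u) x.2.2.1 x.2.2.2.1
  else (x.2.2.2.2.getD (x.2.2.2.2.length - 1) []).sum

/-- A node joins the set with the chosen index if it belongs to it. -/
def cliqueOutput (n₀ : ℕ) (x : CliqueView) : Bool :=
  decide (member n₀ x.1 x.2.1 (cliquePrefix x.1 x.2.2.2.2 5) x.2.2.1 = 1)

theorem primrec_cliqueSend (n₀ : ℕ) :
    Primrec fun p : CliqueView × ℕ => cliqueSend n₀ p.1 p.2 := by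
  unfold cliqueSend CliqueView
  fun_prop

theorem primrec_cliqueOutput (n₀ : ℕ) : Primrec fun x : CliqueView => cliqueOutput n₀ x := by
  unfold cliqueOutput CliqueView
  fun_prop

/-- Choose a good set from the table, one digit of its index in two rounds. -/
def cliqueAlgorithm (n₀ : ℕ) : CliqueAlgorithm where
  send := cliqueSend n₀
  output := cliqueOutput n₀
  send_computable := (primrec_cliqueSend n₀).to_comp
  output_computable := (primrec_cliqueOutput n₀).to_comp

theorem CliqueAlgorithm.transcript_eq (A : CliqueAlgorithm) {n : ℕ} (G : SimpleGraph (Fin n))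
    [DecidableRel G.Adj] (q t : ℕ) (v : Fin n) :
    A.transcript G q t v = (List.range t).map fun i =>
      List.ofFn fun u : Fin n => A.send (A.view G q i u) (v : ℕ) := by
  induction t with
  | zero => rfl
  | succ t ih => rw [List.range_succ, List.map_append, ← ih]; rfl

section

variable {n : ℕ} (G : SimpleGraph (Fin n)) [DecidableRel G.Adj] (n₀ q : ℕ)

theorem getD_transcript (A : CliqueAlgorithm) {t τ : ℕ} (h : t < τ) (v : Fin n) :
    (A.transcript G q τ v).getD t [] =
      List.ofFn fun u : Fin n => A.send (A.view G q t u) (v : ℕ) := by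
  rw [A.transcript_eq, List.getD_eq_getElem _ _ (by simpa using h)]
  simp

theorem sum_blockCost_eq (w y : ℕ) :
    ∑ v : Fin n, blockCost n₀ n q w y v (neighborList G v) =
      ∑ i ∈ Finset.range w, graphCost G n₀ q (y * w + i) := by
  simp only [blockCost, graphCost]
  rw [Finset.sum_comm]

theorem length_transcript (A : CliqueAlgorithm) (t : ℕ) (v : Fin n) :
    (A.transcript G q t v).length = t := by
  rw [A.transcript_eq]; simp

theorem cliqueSend_view_even (t : ℕ) (v : Fin n) (u : ℕ) :
    (cliqueAlgorithm n₀).send ((cliqueAlgorithm n₀).view G q (2 * t) v) u =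
      blockCost n₀ n q (n ^ (4 - t))
        (cliquePrefix n ((cliqueAlgorithm n₀).transcript G q (2 * t) v) t * n + u) v
        (neighborList G v) := by
  change cliqueSend n₀ _ u = _
  simp only [cliqueSend, CliqueAlgorithm.view, length_transcript]
  rw [if_pos (by omega), show 2 * t / 2 = t by omega]

theorem cliqueSend_view_odd (t : ℕ) (v : Fin n) (u : ℕ) :
    (cliqueAlgorithm n₀).send ((cliqueAlgorithm n₀).view G q (2 * t + 1) v) u =
      ∑ w : Fin n,
        (cliqueAlgorithm n₀).send ((cliqueAlgorithm n₀).view G q (2 * t) w) (v : ℕ) := by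
  change cliqueSend n₀ _ u = _
  simp only [cliqueSend, CliqueAlgorithm.view, length_transcript]
  rw [if_neg (by omega), Nat.add_sub_cancel, getD_transcript G q _ (Nat.lt_succ_self _),
    List.sum_ofFn]
  rfl

/-- The totals received in round `2 * t + 1` depend on what all nodes believed the prefix to be in
round `2 * t`, so the induction must cover all nodes and all later times. -/
theorem cliquePrefix_transcript (t τ : ℕ) (h : 2 * t ≤ τ) (v : Fin n) :
    cliquePrefix n ((cliqueAlgorithm n₀).transcript G q τ v) t =
      chosenPrefix n (graphCost G n₀ q) t := by
  induction t generalizing τ v with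
  | zero => rfl
  | succ t ih =>
    rw [chosenPrefix_succ]
    change cliquePrefix n ((cliqueAlgorithm n₀).transcript G q τ v) t * n + _ = _
    rw [ih τ (by omega) v]
    congr 1
    refine select_congr (fun j hj => ?_) v.pos
    rw [getD_transcript G q _ (by omega), List.getD_eq_getElem _ _ (by simpa using hj),
      List.getElem_ofFn, cliqueSend_view_odd]
    simp only [cliqueSend_view_even, ih (2 * t) le_rfl]
    exact sum_blockCost_eq G n₀ q _ _

theorem degree_le (v : Fin n) : (neighborList G v).length ≤ n := by
  rw [length_neighborList]
  simpa using (G.degree_lt_card_verts v).le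

/-- The set with the chosen index. -/
def chosenSet : Finset (Fin n) :=
  Finset.univ.filter fun v : Fin n =>
    member n₀ n q (chosenPrefix n (graphCost G n₀ q) 5) v = 1

theorem mem_chosenSet (v : Fin n) :
    v ∈ chosenSet G n₀ q ↔ member n₀ n q (chosenPrefix n (graphCost G n₀ q) 5) v = 1 := by
  simp [chosenSet]

theorem two_mul_pow_lt {n : ℕ} (hn : 2 ≤ n) (k : ℕ) : 2 * n ^ k < n ^ (k + 2) := by
  have : 0 < n ^ k := by positivity
  calc 2 * n ^ k < n * n * n ^ k := Nat.mul_lt_mul_of_pos_right (by nlinarith) this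
    _ = n ^ (k + 2) := by ring

theorem cliqueAlgorithm_computes (hn : 2 ≤ n) :
    (cliqueAlgorithm n₀).Computes G q 10 (10 * (Nat.log 2 n + 1)) (chosenSet G n₀ q) := by
  have heven : ∀ t (v u : Fin n), (cliqueAlgorithm n₀).send
      ((cliqueAlgorithm n₀).view G q (2 * t) v) (u : ℕ) ≤ 2 * n ^ 7 := by
    intro t v u
    rw [cliqueSend_view_even]
    exact blockCost_le (degree_le G v) (by omega)
  refine ⟨fun t _ v u => size_le_of_lt_pow ?_, fun v => ?_⟩
  · rcases Nat.even_or_odd' t with ⟨k, rfl | rfl⟩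
    · exact (heven k v u).trans_lt ((two_mul_pow_lt hn 7).trans_le
        (Nat.pow_le_pow_right (by omega) (by norm_num)))
    · rw [cliqueSend_view_odd]
      -- The totals sent in odd rounds are the largest messages; `2 * n ^ 8 < n ^ 10` is the source
      -- of the constant `10` in the bit bound.
      calc _ ≤ ∑ w : Fin n, 2 * n ^ 7 := Finset.sum_le_sum fun w _ => heven k w v
        _ = 2 * n ^ 8 := by simp; ring
        _ < n ^ 10 := two_mul_pow_lt hn 8
  · rw [mem_chosenSet]
    change _ ↔ cliqueOutput n₀ _ = true
    rw [cliqueOutput, decide_eq_true_eq]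
    change _ ↔ member n₀ n q (cliquePrefix n
      ((cliqueAlgorithm n₀).transcript G q 10 v) 5) v = 1
    rw [cliquePrefix_transcript G n₀ q 5 10 le_rfl]

end

/-! ### The MPC algorithm -/

/-- The message of machine `i` to machine `j` if both are among the first `W` machines. -/
def guarded (W i j : ℕ) (l : List ℕ) : List ℕ := if i < W then (if j < W then l else []) else []

/-- The entries of the vector `x 0, …, x (n - 1)` for which machine `j` out of `W` is responsible. -/
def share (n W j : ℕ) (x : ℕ → ℕ) : List ℕ := (List.range (n / W + 1)).map fun k => x (j + W * k)

/-- The sum of the received shares. -/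
def combine (n W : ℕ) (r : List (List ℕ)) : List ℕ :=
  (List.range (n / W + 1)).map fun k => (r.map fun l => l.getD k 0).sum

/-- Entry `c` of a vector that is spread over `W` machines. -/
def gather (W : ℕ) (r : List (List ℕ)) (c : ℕ) : ℕ := (r.getD (c % W) []).getD (c / W) 0

/-- The machine that is responsible for vertex `v`. If there are fewer machines than vertices, then
`D` starts with the degrees of the vertices. -/
def owner (n S M : ℕ) (D : List ℕ) (v : ℕ) : ℕ := if M < n then (D.take v).sum / S else v

/-- The words that describe the edge `uv` to machine `j`, if the owners of `u` and `v` are machines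
`a` and `b`. -/
def route (n j a b u v : ℕ) : List ℕ :=
  (if a = j then [u * n + v] else []) ++ (if b = j then [v * n + u] else [])

/-- The vertices that are listed in `P` as neighbours of `u`. -/
def adjacent (n : ℕ) (P : List ℕ) (u : ℕ) : List ℕ :=
  P.flatMap fun x => if x / n = u then [x % n] else []

/-- The cost of block `y` for all vertices whose neighbours are listed in `P`. -/
def localCost (n₀ n q w y : ℕ) (P : List ℕ) : ℕ :=
  ∑ u ∈ Finset.range n, blockCost n₀ n q w y u (adjacent n P u)

/-- Rounds `0` and `1` compute the degrees if there are fewer machines than vertices, round `2` sends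
the edges to the owners of their ends, and then any two rounds choose one digit. -/
def machineSend (n₀ n S M q i t : ℕ) (mem : List ℕ) (j : ℕ) : List ℕ :=
  if t = 0 then
    if M < n then guarded (min M n) i j
      (share n (min M n) j fun v => (mem.map fun x => if x = v then 1 else 0).sum)
    else []
  else if t = 1 then
    if M < n then guarded (min M n) i j (mem.take (n / min M n + 1)) else []
  else if t = 2 then
    (List.range ((mem.drop (if M < n then n else 0)).length / 2)).flatMap fun k =>
      route n j (owner n S M mem ((mem.drop (if M < n then n else 0)).getD (2 * k) 0))
        (owner n S M mem ((mem.drop (if M < n then n else 0)).getD (2 * k + 1) 0))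
        ((mem.drop (if M < n then n else 0)).getD (2 * k) 0)
        ((mem.drop (if M < n then n else 0)).getD (2 * k + 1) 0)
  else if t % 2 = 1 then
    guarded (min M n) i j (share n (min M n) j fun c =>
      localCost n₀ n q (n ^ (4 - (t - 3) / 2)) (mem.getD 0 0 * n + c) (mem.drop 1))
  else guarded (min M n) i j ((mem.drop 1).take (n / min M n + 1))

/-- The new memory after the round. From round `3` on, the first word is the chosen prefix. -/
def machineUpdate (n M t : ℕ) (mem : List ℕ) (r : List (List ℕ)) : List ℕ :=
  if t = 0 then
    if M < n then combine n (min M n) r ++ mem else mem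
  else if t = 1 then
    if M < n then ((List.range n).map fun c => gather (min M n) r c) ++
      mem.drop (n / min M n + 1)
    else mem
  else if t = 2 then 0 :: r.flatten
  else if t % 2 = 1 then mem.getD 0 0 :: (combine n (min M n) r ++ mem.drop 1)
  else (mem.getD 0 0 * n + select n fun c => gather (min M n) r c) ::
    -- The discarded words are the old prefix and a share of length `n / min M n + 1`.
    mem.drop (n / min M n + 2)

/-- Machine `0` outputs the chosen set. -/
def machineOutput (n₀ n q i : ℕ) (mem : List ℕ) : List ℕ :=
  if i = 0 then (List.range n).flatMap fun v =>
    if member n₀ n q (mem.getD 0 0) v = 1 then [v] else []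
  else []

@[fun_prop]
theorem primrec_localCost {α : Type*} [Primcodable α] (n₀ : ℕ) {n q w y : α → ℕ}
    {P : α → List ℕ} (hn : Primrec n) (hq : Primrec q) (hw : Primrec w) (hy : Primrec y)
    (hP : Primrec P) :
    Primrec fun a => localCost n₀ (n a) (q a) (w a) (y a) (P a) := by
  unfold localCost adjacent
  fun_prop

@[fun_prop]
theorem primrec_guarded {α : Type*} [Primcodable α] {W i j : α → ℕ} {l : α → List ℕ}
    (hW : Primrec W) (hi : Primrec i) (hj : Primrec j) (hl : Primrec l) :
    Primrec fun a => guarded (W a) (i a) (j a) (l a) := by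
  unfold guarded
  fun_prop

@[fun_prop]
theorem primrec_share {α : Type*} [Primcodable α] {n W j : α → ℕ} {x : α → ℕ → ℕ}
    (hn : Primrec n) (hW : Primrec W) (hj : Primrec j)
    (hx : Primrec fun p : α × ℕ => x p.1 p.2) :
    Primrec fun a => share (n a) (W a) (j a) (x a) := by
  unfold share
  have h : Primrec fun p : α × ℕ => j p.1 + W p.1 * p.2 := by fun_prop
  have : Primrec fun p : α × ℕ => x p.1 (j p.1 + W p.1 * p.2) :=
    hx.comp (Primrec.fst.pair h)
  fun_prop

@[fun_prop]
theorem primrec_owner {α : Type*} [Primcodable α] {n S M v : α → ℕ} {D : α → List ℕ}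
    (hn : Primrec n) (hS : Primrec S) (hM : Primrec M) (hD : Primrec D) (hv : Primrec v) :
    Primrec fun a => owner (n a) (S a) (M a) (D a) (v a) := by
  unfold owner
  fun_prop

@[fun_prop]
theorem primrec_route {α : Type*} [Primcodable α] {n j a b u v : α → ℕ}
    (hn : Primrec n) (hj : Primrec j) (ha : Primrec a) (hb : Primrec b) (hu : Primrec u)
    (hv : Primrec v) :
    Primrec fun x => route (n x) (j x) (a x) (b x) (u x) (v x) := by
  unfold route
  fun_prop

@[fun_prop]
theorem primrec_combine {α : Type*} [Primcodable α] {n W : α → ℕ} {r : α → List (List ℕ)}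
    (hn : Primrec n) (hW : Primrec W) (hr : Primrec r) :
    Primrec fun a => combine (n a) (W a) (r a) := by
  unfold combine
  fun_prop

@[fun_prop]
theorem primrec_gather {α : Type*} [Primcodable α] {W c : α → ℕ} {r : α → List (List ℕ)}
    (hW : Primrec W) (hr : Primrec r) (hc : Primrec c) :
    Primrec fun a => gather (W a) (r a) (c a) := by
  unfold gather
  fun_prop

theorem primrec_machineSend {α : Type*} [Primcodable α] (n₀ : ℕ) {n S M q i t j : α → ℕ}
    {mem : α → List ℕ} (hn : Primrec n) (hS : Primrec S) (hM : Primrec M) (hq : Primrec q)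
    (hi : Primrec i) (ht : Primrec t) (hmem : Primrec mem) (hj : Primrec j) :
    Primrec fun a => machineSend n₀ (n a) (S a) (M a) (q a) (i a) (t a) (mem a) (j a) := by
  unfold machineSend
  fun_prop

theorem primrec_machineUpdate {α : Type*} [Primcodable α] {n M t : α → ℕ}
    {mem : α → List ℕ} {r : α → List (List ℕ)} (hn : Primrec n) (hM : Primrec M)
    (ht : Primrec t) (hmem : Primrec mem) (hr : Primrec r) :
    Primrec fun a => machineUpdate (n a) (M a) (t a) (mem a) (r a) := by
  unfold machineUpdate
  fun_prop

theorem primrec_machineOutput (n₀ : ℕ) : Primrec fun p : MPCContext × List ℕ =>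
    machineOutput n₀ p.1.1 p.1.2.2.2.1 p.1.2.2.2.2 p.2 := by
  unfold machineOutput MPCContext
  fun_prop

/-- Compute the same set as the Congested Clique algorithm. -/
def mpcAlgorithm (n₀ : ℕ) : MPCAlgorithm where
  send p j := machineSend n₀ p.1.1 p.1.2.1 p.1.2.2.1 p.1.2.2.2.1 p.1.2.2.2.2 p.2.1 p.2.2 j
  update p := machineUpdate p.1.1 p.1.2.2.1 p.2.1 p.2.2.1 p.2.2.2
  output p := machineOutput n₀ p.1.1 p.1.2.2.2.1 p.1.2.2.2.2 p.2
  send_computable := by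
    refine Primrec.to_comp (primrec_machineSend n₀ ?_ ?_ ?_ ?_ ?_ ?_ ?_ ?_) <;>
      (unfold MPCContext; fun_prop)
  update_computable := by
    refine Primrec.to_comp (primrec_machineUpdate ?_ ?_ ?_ ?_ ?_) <;>
      (unfold MPCContext; fun_prop)
  output_computable := (primrec_machineOutput n₀).to_comp

/-! ### Aggregation -/

theorem length_share (n W j : ℕ) (x : ℕ → ℕ) : (share n W j x).length = n / W + 1 := by
  simp [share]

theorem getD_share {n W j k : ℕ} (x : ℕ → ℕ) (hk : k < n / W + 1) :
    (share n W j x).getD k 0 = x (j + W * k) := by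
  rw [List.getD_eq_getElem _ _ (by simpa [share] using hk)]
  simp [share]

/-- Adding shares entrywise commutes with taking the share of a sum. Receivers outside the first `W`
machines get empty messages and read the default `0`. -/
theorem combine_guarded_share {M : ℕ} (n W j : ℕ) (x : Fin M → ℕ → ℕ) :
    combine n W (List.ofFn fun i : Fin M => guarded W i j (share n W j (x i))) =
      share n W j fun c => ∑ i : Fin M, if (i : ℕ) < W ∧ j < W then x i c else 0 := by
  refine List.map_congr_left fun k hk => ?_
  rw [List.map_ofFn, List.sum_ofFn]
  refine Finset.sum_congr rfl fun i _ => ?_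
  simp only [Function.comp, guarded, ite_and]
  split_ifs
  · exact getD_share _ (List.mem_range.1 hk)
  · simp
  · simp

/-- Coordinate `c = c % W + W * (c / W)` is entry `c / W` of the share of machine `c % W`. -/
theorem gather_guarded_share {n M W j c : ℕ} (hW : 0 < W) (hWM : W ≤ M) (hj : j < W)
    (hc : c < n) (y : ℕ → ℕ → ℕ) :
    gather W (List.ofFn fun i : Fin M => guarded W i j (share n W i (y i))) c = y (c % W) c := by
  have h1 : c % W < W := Nat.mod_lt _ hW
  have h2 : c % W < (List.ofFn fun i : Fin M =>
      guarded W i j (share n W i (y i))).length := by simpa using h1.trans_le hWM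
  rw [gather, List.getD_eq_getElem _ _ h2, List.getElem_ofFn, guarded, if_pos h1,
    if_pos hj, getD_share _ (Nat.lt_succ_of_le (Nat.div_le_div_right hc.le)),
    Nat.mod_add_div]

/-- At most `W` partners with `n / W + 1` words each make at most `n + W` words; this is why at most
`n` machines take part. -/
theorem sum_guarded_length_le {n M W : ℕ} (hWn : W ≤ n)
    (p : Fin M → List ℕ) (hp : ∀ j : Fin M, (p j).length ≤ if (j : ℕ) < W then n / W + 1 else 0) :
    ∑ j, (p j).length ≤ 2 * n := by
  calc ∑ j, (p j).length ≤ ∑ j : Fin M, if (j : ℕ) < W then n / W + 1 else 0 :=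
        Finset.sum_le_sum fun j _ => hp j
    _ = ((Finset.univ : Finset (Fin M)).filter fun j : Fin M => (j : ℕ) < W).card *
          (n / W + 1) := by
        rw [← Finset.sum_filter, Finset.sum_const, smul_eq_mul]
    _ ≤ W * (n / W + 1) := by
        refine Nat.mul_le_mul_right _ ?_
        calc _ ≤ (Finset.range W).card := Finset.card_le_card_of_injOn Fin.val
              (fun j hj => by simpa using hj) (Fin.val_injective.injOn)
          _ = W := Finset.card_range W
    _ ≤ 2 * n := by rw [mul_add]; have := Nat.mul_div_le n W; omega

/-! ### The distribution of the edges -/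

section Distribution

variable {n M : ℕ}

/-- The other ends of the edges in `l` that have the end `u`. -/
def incident (l : List (Fin n × Fin n)) (u : ℕ) : List (Fin n) :=
  l.flatMap fun p => (if (p.1 : ℕ) = u then [p.2] else []) ++ if (p.2 : ℕ) = u then [p.1] else []

/-- The neighbours of `u` according to all machines. -/
def allIncident (input : Fin M → List (Fin n × Fin n)) (u : ℕ) : List (Fin n) :=
  (List.ofFn fun j => incident (input j) u).flatten

/-- The words by which an input list is stored. -/
def flatWords (l : List (Fin n × Fin n)) : List ℕ := l.flatMap fun p => [(p.1 : ℕ), (p.2 : ℕ)]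

/-- The words that are sent to machine `i` on behalf of the edges in `l`. -/
def routed (own : ℕ → ℕ) (i : ℕ) (l : List (Fin n × Fin n)) : List ℕ :=
  l.flatMap fun p => route n i (own p.1) (own p.2) p.1 p.2

/-- The words that are sent to machine `i` by all machines. -/
def received (input : Fin M → List (Fin n × Fin n)) (own : ℕ → ℕ) (i : ℕ) : List ℕ :=
  (List.ofFn fun j => routed own i (input j)).flatten

theorem length_flatWords (l : List (Fin n × Fin n)) : (flatWords l).length = 2 * l.length := by
  induction l with
  | nil => rfl
  | cons p l ih => simp only [flatWords, List.flatMap_cons, List.length_append] at ih ⊢; simp; omega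

theorem lt_of_mem_flatWords {l : List (Fin n × Fin n)} {x : ℕ} (h : x ∈ flatWords l) : x < n := by
  simp only [flatWords, List.mem_flatMap, List.mem_cons, List.not_mem_nil, or_false] at h
  obtain ⟨p, -, rfl | rfl⟩ := h
  exacts [p.1.2, p.2.2]

theorem sum_map_flatWords (l : List (Fin n × Fin n)) (c : ℕ) :
    ((flatWords l).map fun x => if x = c then 1 else 0).sum = (incident l c).length := by
  induction l with
  | nil => rfl
  | cons p l ih =>
    simp only [flatWords, incident, List.flatMap_cons, List.map_append, List.sum_append,
      List.length_append] at ih ⊢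
    rw [ih]
    congr 1
    simp only [List.map_cons, List.map_nil, List.sum_cons, List.sum_nil]
    split_ifs <;> rfl

theorem count_incident (l : List (Fin n × Fin n)) (u w : Fin n) (huw : u ≠ w) :
    (incident l u).count w = (l.map fun p => s(p.1, p.2)).count s(u, w) := by
  induction l with
  | nil => rfl
  | cons p l ih =>
    simp only [incident, List.flatMap_cons, List.count_append, List.map_cons,
      List.count_cons] at ih ⊢
    rw [ih, add_comm]
    congr 1
    obtain ⟨a, b⟩ := p
    simp only [← Fin.ext_iff, beq_iff_eq, Sym2.eq_iff]
    by_cases h1 : a = u <;> by_cases h2 : b = w <;> by_cases h3 : a = w <;> by_cases h4 : b = u <;>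
      simp_all

theorem count_incident_self {l : List (Fin n × Fin n)} {u : Fin n}
    (h : (l.map fun p => s(p.1, p.2)).count s(u, u) = 0) : (incident l u).count u = 0 := by
  rw [List.count_eq_zero] at h ⊢
  intro hu
  apply h
  simp only [incident, List.mem_flatMap, List.mem_append, ← Fin.ext_iff] at hu
  obtain ⟨p, hp, hpu⟩ := hu
  refine List.mem_map.2 ⟨p, hp, ?_⟩
  by_cases h1 : p.1 = u <;> by_cases h2 : p.2 = u <;> simp_all

/-- Compare multiplicities: every edge is stored exactly once, in one orientation, and `incident`
looks at both ends. The diagonal is separate, since a loop would be counted twice. -/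
theorem allIncident_perm {G : SimpleGraph (Fin n)} [DecidableRel G.Adj] {S : ℕ}
    {input : Fin M → List (Fin n × Fin n)} (h : IsDistribution G S input) (u : Fin n) :
    (allIncident input u).Perm ((List.finRange n).filter fun w => G.Adj u w) := by
  rw [List.perm_iff_count]
  intro w
  rw [allIncident, List.count_flatten, List.map_ofFn, List.sum_ofFn]
  have hw := h.1 s(u, w)
  have hr : ((List.finRange n).filter fun w => G.Adj u w).count w = if G.Adj u w then 1 else 0 := by
    rw [List.Nodup.count ((List.nodup_finRange n).filter _)]
    simp
  rw [hr]
  simp only [SimpleGraph.mem_edgeSet] at hw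
  by_cases huw : u = w
  · subst huw
    rw [if_neg (G.irrefl)] at hw ⊢
    rw [Finset.sum_eq_zero_iff] at hw ⊢
    exact fun j hj => count_incident_self (hw j hj)
  · rw [← hw]
    exact Finset.sum_congr rfl fun j _ => count_incident _ u w huw

theorem allIncident_of_ge (input : Fin M → List (Fin n × Fin n)) {u : ℕ} (hu : n ≤ u) :
    allIncident input u = [] := by
  simp only [allIncident, List.flatten_eq_nil_iff, List.mem_ofFn]
  rintro l ⟨j, rfl⟩
  simp only [incident, List.flatMap_eq_nil_iff]
  intro p _
  rw [if_neg (by have := p.1.2; omega), if_neg (by have := p.2.2; omega)]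
  rfl

theorem length_allIncident_le {G : SimpleGraph (Fin n)} [DecidableRel G.Adj] {S : ℕ}
    {input : Fin M → List (Fin n × Fin n)} (h : IsDistribution G S input) (u : ℕ) :
    (allIncident input u).length ≤ n := by
  rcases lt_or_ge u n with hu | hu
  · rw [(allIncident_perm h ⟨u, hu⟩).length_eq]
    exact (List.length_filter_le _ _).trans (by simp)
  · rw [allIncident_of_ge input hu]
    exact Nat.zero_le _

theorem length_allIncident (input : Fin M → List (Fin n × Fin n)) (u : ℕ) :
    (allIncident input u).length = ∑ j, (incident (input j) u).length := by
  rw [allIncident, List.length_flatten, List.map_ofFn, List.sum_ofFn]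
  rfl

theorem sum_length_incident (l : List (Fin n × Fin n)) :
    ∑ u ∈ Finset.range n, (incident l u).length = 2 * l.length := by
  induction l with
  | nil => simp [incident]
  | cons p l ih =>
    simp only [incident, List.flatMap_cons, List.length_append, List.length_cons] at ih ⊢
    rw [Finset.sum_add_distrib, ih, Finset.sum_add_distrib]
    have h : ∀ a b : Fin n, ∑ u ∈ Finset.range n,
        (if (a : ℕ) = u then [b] else []).length = 1 := by
      intro a b
      rw [Finset.sum_eq_single (a : ℕ)]
      · simp
      · intro u _ hu; rw [if_neg hu.symm]; rfl
      · intro ha; exact absurd (Finset.mem_range.2 a.2) ha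
    rw [h, h]; ring

/-- Every stored edge adds two to the degree sum and takes two words of input. -/
theorem sum_length_allIncident_le {G : SimpleGraph (Fin n)} [DecidableRel G.Adj] {S : ℕ}
    {input : Fin M → List (Fin n × Fin n)} (h : IsDistribution G S input) :
    ∑ u ∈ Finset.range n, (allIncident input u).length ≤ M * S := by
  simp only [length_allIncident]
  rw [Finset.sum_comm]
  simp only [sum_length_incident]
  calc _ ≤ ∑ _j : Fin M, S := Finset.sum_le_sum fun j _ => h.2 j
    _ = M * S := by simp

/-! ### Routing -/

theorem adjacent_append (P Q : List ℕ) (u : ℕ) :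
    adjacent n (P ++ Q) u = adjacent n P u ++ adjacent n Q u := by simp [adjacent]

theorem adjacent_flatten (L : List (List ℕ)) (u : ℕ) :
    adjacent n L.flatten u = (L.map fun P => adjacent n P u).flatten := by
  induction L with
  | nil => rfl
  | cons P L ih => rw [List.flatten_cons, adjacent_append, ih, List.map_cons, List.flatten_cons]

theorem adjacent_route (own : ℕ → ℕ) (i u : ℕ) (a b : Fin n) :
    adjacent n (route n i (own a) (own b) a b) u = if own u = i then
      ((if (a : ℕ) = u then [b] else []) ++ if (b : ℕ) = u then [a] else []).map Fin.val
    else [] := by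
  have h : ∀ a b : Fin n, adjacent n (if own a = i then [(a : ℕ) * n + b] else []) u =
      if own u = i then (if (a : ℕ) = u then [b] else []).map Fin.val else [] := by
    intro a b
    have h1 : ((a : ℕ) * n + b) / n = a := by
      rw [mul_comm, Nat.mul_add_div a.pos, Nat.div_eq_of_lt b.2, add_zero]
    have h2 : ((a : ℕ) * n + b) % n = b := by
      rw [mul_comm, Nat.mul_add_mod, Nat.mod_eq_of_lt b.2]
    by_cases hu : (a : ℕ) = u
    · subst hu
      by_cases hi : own a = i <;> simp [adjacent, hi, h1, h2]
    · by_cases hi : own a = i <;> simp [adjacent, hi, h1, hu]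
  rw [route, adjacent_append, h, h]
  split_ifs <;> simp

theorem adjacent_routed (own : ℕ → ℕ) (i u : ℕ) (l : List (Fin n × Fin n)) :
    adjacent n (routed own i l) u =
      if own u = i then (incident l u).map Fin.val else [] := by
  induction l with
  | nil => simp [routed, incident, adjacent]
  | cons p l ih =>
    simp only [routed, incident, List.flatMap_cons] at ih ⊢
    rw [adjacent_append, ih, adjacent_route]
    split_ifs <;> simp

/-- After routing, a machine knows the whole neighbourhood of each vertex that it owns, and nothing
that could be mistaken for part of a neighbourhood of another vertex. -/
theorem adjacent_received (input : Fin M → List (Fin n × Fin n)) (own : ℕ → ℕ) (i u : ℕ) :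
    adjacent n (received input own i) u =
      if own u = i then (allIncident input u).map Fin.val else [] := by
  have h : adjacent n (received input own i) u =
      (List.ofFn fun j => adjacent n (routed own i (input j)) u).flatten := by
    rw [received, adjacent_flatten, List.map_ofFn]
    rfl
  rw [h]
  simp only [adjacent_routed]
  split_ifs with hi
  · rw [allIncident, List.map_flatten, List.map_ofFn]; rfl
  · simp

theorem lt_of_mem_route {i a b : ℕ} {u v : Fin n} {x : ℕ} (h : x ∈ route n i a b u v) :
    x < n ^ 2 := by
  have key : ∀ u v : Fin n, (u : ℕ) * n + v < n ^ 2 := by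
    intro u v
    calc (u : ℕ) * n + v < (u + 1) * n := by rw [add_mul]; have := v.2; omega
      _ ≤ n * n := Nat.mul_le_mul_right _ u.2
      _ = n ^ 2 := by ring
  simp only [route, List.mem_append] at h
  rcases h with h | h
  · split_ifs at h
    · rw [List.mem_singleton.1 h]; exact key u v
    · simp at h
  · split_ifs at h
    · rw [List.mem_singleton.1 h]; exact key v u
    · simp at h

theorem lt_of_mem_routed {own : ℕ → ℕ} {i x : ℕ} {l : List (Fin n × Fin n)}
    (h : x ∈ routed own i l) : x < n ^ 2 := by
  obtain ⟨p, -, hp⟩ := List.mem_flatMap.1 h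
  exact lt_of_mem_route hp

theorem lt_of_mem_received {input : Fin M → List (Fin n × Fin n)} {own : ℕ → ℕ} {i x : ℕ}
    (h : x ∈ received input own i) : x < n ^ 2 := by
  obtain ⟨l, hl, hx⟩ := List.mem_flatten.1 h
  obtain ⟨j, rfl⟩ := List.mem_ofFn.1 hl
  exact lt_of_mem_routed hx

/-- The words are `u * n + v` with `u, v < n`; sort them by the quotient `x / n`. -/
theorem length_eq_sum_adjacent {P : List ℕ} (hP : ∀ x ∈ P, x < n ^ 2) :
    P.length = ∑ u ∈ Finset.range n, (adjacent n P u).length := by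
  induction P with
  | nil => simp [adjacent]
  | cons x P ih =>
    have hx : x / n < n := Nat.div_lt_of_lt_mul (by simpa [sq] using hP x (by simp))
    simp only [adjacent, List.flatMap_cons, List.length_append] at ih ⊢
    rw [Finset.sum_add_distrib, List.length_cons, ih fun y hy => hP y (by simp [hy]), add_comm]
    congr 1
    rw [Finset.sum_eq_single (x / n)]
    · simp
    · intro u _ hu; rw [if_neg hu.symm]; rfl
    · intro h; exact absurd (Finset.mem_range.2 hx) h

theorem length_received (input : Fin M → List (Fin n × Fin n)) (own : ℕ → ℕ) (i : ℕ) :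
    (received input own i).length =
      ∑ u ∈ Finset.range n, if own u = i then (allIncident input u).length else 0 := by
  rw [length_eq_sum_adjacent (n := n) fun x hx => lt_of_mem_received hx]
  refine Finset.sum_congr rfl fun u _ => ?_
  rw [adjacent_received]
  split_ifs <;> simp

/-- Each edge goes to the owners of its two ends only. -/
theorem sum_length_routed_le (own : ℕ → ℕ) (l : List (Fin n × Fin n)) :
    ∑ j : Fin M, (routed own j l).length ≤ 2 * l.length := by
  induction l with
  | nil => simp [routed]
  | cons p l ih =>
    simp only [routed, List.flatMap_cons, List.length_append, route, List.length_cons] at ih ⊢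
    rw [Finset.sum_add_distrib, Finset.sum_add_distrib]
    have h : ∀ a x : ℕ, ∑ j : Fin M, (if a = j then [x] else []).length ≤ 1 := by
      intro a x
      have e : ∀ j : Fin M, (if a = j then [x] else []).length = if a = (j : ℕ) then 1 else 0 := by
        intro j; split_ifs <;> rfl
      simp only [e]
      rw [Finset.sum_boole]
      simp only [Nat.cast_id]
      refine Finset.card_le_one.2 fun i hi j hj => ?_
      simp only [Finset.mem_filter, Finset.mem_univ, true_and] at hi hj
      exact Fin.ext (hi.symm.trans hj)
    have h1 := h (own p.1) (p.1 * n + p.2)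
    have h2 := h (own p.2) (p.2 * n + p.1)
    omega

theorem flatMap_range_flatWords (l : List (Fin n × Fin n)) (h : ℕ → ℕ → List ℕ) :
    ((List.range ((flatWords l).length / 2)).flatMap fun k =>
      h ((flatWords l).getD (2 * k) 0) ((flatWords l).getD (2 * k + 1) 0)) =
      l.flatMap fun p => h p.1 p.2 := by
  rw [length_flatWords, Nat.mul_div_cancel_left _ two_pos]
  induction l with
  | nil => rfl
  | cons p l ih =>
    rw [List.length_cons, List.range_succ_eq_map, List.flatMap_cons, List.flatMap_cons,
      List.flatMap_map, ← ih]
    have e : flatWords (p :: l) = (p.1 : ℕ) :: (p.2 : ℕ) :: flatWords l := rfl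
    rw [e]
    congr 1

/-! ### Owners -/

/-- The machine that is responsible for vertex `v`. -/
def vertexOwner (S : ℕ) (input : Fin M → List (Fin n × Fin n)) (v : ℕ) : ℕ :=
  owner n S M ((List.range n).map fun c => (allIncident input c).length) v

theorem sum_take_map_range (f : ℕ → ℕ) {v : ℕ} (hv : v ≤ n) :
    (((List.range n).map f).take v).sum = ∑ u ∈ Finset.range v, f u := by
  rw [← List.map_take, List.take_range, min_eq_left hv, Finset.sum_range]
  rw [← List.sum_ofFn]
  congr 1
  refine List.ext_getElem (by simp) fun i _ _ => by simp

/-- A positive degree makes the prefix sum before `u` strictly smaller than the degree sum, hence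
than `M * S`. An isolated vertex may be assigned to a machine that does not exist. -/
theorem vertexOwner_lt {G : SimpleGraph (Fin n)} [DecidableRel G.Adj] {S : ℕ}
    {input : Fin M → List (Fin n × Fin n)} (h : IsDistribution G S input) {u : ℕ} (hu : u < n)
    (hpos : 0 < (allIncident input u).length) : vertexOwner S input u < min M n := by
  rw [vertexOwner, owner]
  split_ifs with hM
  · rw [sum_take_map_range _ hu.le, min_eq_left hM.le]
    refine Nat.div_lt_of_lt_mul ?_
    have h1 := sum_length_allIncident_le h
    have h2 : ∑ v ∈ Finset.range (u + 1), (allIncident input v).length ≤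
        ∑ v ∈ Finset.range n, (allIncident input v).length :=
      Finset.sum_le_sum_of_subset (Finset.range_mono hu)
    rw [Finset.sum_range_succ] at h2
    rw [mul_comm]
    omega
  · rw [min_eq_right (not_lt.1 hM)]; exact hu

/-- The items of block `i` start at prefix sums in `[S * i, S * (i + 1))`, so only the last one can
overshoot, by at most `A`. The `max` and `min` make this an invariant in `k`: the load is the growth
of the prefix sum beyond `S * i`, and it stops growing after the block has been left. -/
theorem sum_block_le (f : ℕ → ℕ) {S A : ℕ} (hS : 0 < S) (hf : ∀ u, f u ≤ A) (i k : ℕ) :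
    (∑ u ∈ Finset.range k, if (∑ v ∈ Finset.range u, f v) / S = i then f u else 0) + S * i ≤
      max (S * i) (min (∑ v ∈ Finset.range k, f v) (S * (i + 1) + A)) := by
  induction k with
  | zero => simp
  | succ k ih =>
    rw [Finset.sum_range_succ, Finset.sum_range_succ (f := f)]
    have hk := hf k
    split_ifs with h
    · have h1 := Nat.div_mul_le_self (∑ v ∈ Finset.range k, f v) S
      have h2 := Nat.lt_mul_div_succ (∑ v ∈ Finset.range k, f v) hS
      rw [h] at h1 h2
      rw [mul_comm] at h1
      omega
    · omega

theorem length_received_le {G : SimpleGraph (Fin n)} [DecidableRel G.Adj] {S : ℕ}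
    {input : Fin M → List (Fin n × Fin n)} (h : IsDistribution G S input) (hS : 0 < S) (i : ℕ) :
    (received input (vertexOwner S input) i).length ≤ S + n := by
  rw [length_received]
  by_cases hM : M < n
  · have h1 := sum_block_le (fun u => (allIncident input u).length) hS
      (length_allIncident_le h) i n
    have h2 : ∀ u ∈ Finset.range n, vertexOwner S input u =
        (∑ v ∈ Finset.range u, (allIncident input v).length) / S := by
      intro u hu
      rw [vertexOwner, owner, if_pos hM, sum_take_map_range _ (Finset.mem_range.1 hu).le]
    rw [Finset.sum_congr rfl fun u hu => by rw [h2 u hu]]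
    rw [mul_add] at h1
    omega
  · simp only [vertexOwner, owner, if_neg hM]
    rw [Finset.sum_ite_eq']
    split_ifs
    · exact (length_allIncident_le h i).trans (Nat.le_add_left _ _)
    · exact Nat.zero_le _

theorem blockCost_perm {n₀ q w y v : ℕ} {N N' : List ℕ} (h : N.Perm N') :
    blockCost n₀ n q w y v N = blockCost n₀ n q w y v N' := by
  refine Finset.sum_congr rfl fun s _ => ?_
  simp only [cost, h.length_eq, (h.map _).sum_eq]

/-- An empty neighbourhood is never large, as `n ^ 6 > 2 ^ 0`. Hence vertices owned by another
machine, or by none, cost nothing. -/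
theorem blockCost_nil (n₀ : ℕ) {q w y v : ℕ} (hn : 2 ≤ n) : blockCost n₀ n q w y v [] = 0 := by
  refine Finset.sum_eq_zero fun s _ => ?_
  have : 1 < n ^ 6 := Nat.one_lt_pow (by norm_num) hn
  simp [cost, this.not_ge]

theorem localCost_received_le {G : SimpleGraph (Fin n)} [DecidableRel G.Adj] {S : ℕ}
    {input : Fin M → List (Fin n × Fin n)} (h : IsDistribution G S input) (own : ℕ → ℕ)
    (hn : 1 ≤ n) (n₀ q t y i : ℕ) :
    localCost n₀ n q (n ^ (4 - t)) y (received input own i) ≤ 2 * n ^ 8 := by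
  calc _ ≤ ∑ u ∈ Finset.range n, 2 * n ^ 7 := by
        refine Finset.sum_le_sum fun u _ => blockCost_le ?_ hn
        rw [adjacent_received]
        split_ifs
        · simpa using length_allIncident_le h u
        · simp
    _ = 2 * n ^ 8 := by simp; ring

/-- Every vertex of positive degree is charged by exactly one participating machine, with its true
neighbourhood up to order. -/
theorem sum_localCost {G : SimpleGraph (Fin n)} [DecidableRel G.Adj] {S : ℕ}
    {input : Fin M → List (Fin n × Fin n)} (h : IsDistribution G S input) (hn : 2 ≤ n)
    (n₀ q w y : ℕ) :
    (∑ i : Fin M, if (i : ℕ) < min M n then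
      localCost n₀ n q w y (received input (vertexOwner S input) i) else 0) =
      ∑ v : Fin n, blockCost n₀ n q w y v (neighborList G v) := by
  have h1 : ∀ i : ℕ, localCost n₀ n q w y (received input (vertexOwner S input) i) =
      ∑ u : Fin n, if vertexOwner S input u = i then
        blockCost n₀ n q w y u (neighborList G u) else 0 := by
    intro i
    rw [localCost, Finset.sum_range]
    refine Finset.sum_congr rfl fun u _ => ?_
    rw [adjacent_received]
    split_ifs with hi
    · exact blockCost_perm ((allIncident_perm h u).map Fin.val)
    · exact blockCost_nil n₀ hn
  simp only [h1]
  have h2 : ∀ i : Fin M, (if (i : ℕ) < min M n then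
      ∑ u : Fin n, (if vertexOwner S input u = i then
        blockCost n₀ n q w y u (neighborList G u) else 0) else 0) =
      ∑ u : Fin n, if (i : ℕ) < min M n ∧ vertexOwner S input u = i then
        blockCost n₀ n q w y u (neighborList G u) else 0 := by
    intro i
    split_ifs with hi <;> simp [hi]
  simp only [h2]
  rw [Finset.sum_comm]
  refine Finset.sum_congr rfl fun u _ => ?_
  have hperm := (allIncident_perm h u).map Fin.val
  rcases Nat.eq_zero_or_pos (allIncident input u).length with h0 | hpos
  · have hnil : neighborList G u = [] := by
      have := hperm.length_eq
      rw [List.length_map, h0] at this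
      exact List.length_eq_zero_iff.1 this.symm
    simp [hnil, blockCost_nil n₀ hn]
  · have hlt := vertexOwner_lt h u.2 hpos
    rw [Finset.sum_eq_single ⟨vertexOwner S input u, hlt.trans_le (min_le_left _ _)⟩]
    · rw [if_pos ⟨hlt, rfl⟩]
    · intro i _ hi
      rw [if_neg]
      rintro ⟨-, h3⟩
      exact hi (Fin.ext h3.symm)
    · simp

end Distribution

/-! ### Correctness of the MPC algorithm -/

section MPC

variable {n M : ℕ} {G : SimpleGraph (Fin n)} [DecidableRel G.Adj] {S : ℕ}
  {input : Fin M → List (Fin n × Fin n)} (n₀ q : ℕ)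

theorem message_eq (t : ℕ) (i j : Fin M) :
    (mpcAlgorithm n₀).message S q input t i j =
      machineSend n₀ n S M q i t ((mpcAlgorithm n₀).memory S q input t i) j := rfl

theorem memory_succ (t : ℕ) (i : Fin M) :
    (mpcAlgorithm n₀).memory S q input (t + 1) i =
      machineUpdate n M t ((mpcAlgorithm n₀).memory S q input t i)
        (List.ofFn fun j : Fin M => (mpcAlgorithm n₀).message S q input t j i) := rfl

theorem memory_zero (i : Fin M) :
    (mpcAlgorithm n₀).memory S q input 0 i = flatWords (input i) := rfl

theorem message_zero (i j : Fin M) :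
    (mpcAlgorithm n₀).message S q input 0 i j = if M < n then
      guarded (min M n) i j (share n (min M n) j fun c => (incident (input i) c).length)
    else [] := by
  rw [message_eq, machineSend, if_pos rfl, memory_zero]
  simp only [sum_map_flatWords]

theorem memory_one (i : Fin M) :
    (mpcAlgorithm n₀).memory S q input 1 i = (if M < n then
      share n (min M n) i fun c => (allIncident input c).length else []) ++
      flatWords (input i) := by
  rw [memory_succ, machineUpdate, if_pos rfl, memory_zero]
  simp only [message_zero]
  split_ifs with hM
  · rw [combine_guarded_share]
    congr 2
    funext c
    rw [length_allIncident]
    refine Finset.sum_congr rfl fun j _ => ?_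
    rw [min_eq_left hM.le, if_pos ⟨j.2, i.2⟩]
  · rfl

theorem message_one (i j : Fin M) :
    (mpcAlgorithm n₀).message S q input 1 i j = if M < n then
      guarded (min M n) i j (share n (min M n) i fun c => (allIncident input c).length)
    else [] := by
  rw [message_eq, machineSend, if_neg one_ne_zero, if_pos rfl, memory_one]
  split_ifs with hM
  · rw [List.take_left' (length_share _ _ _ _)]
  · rfl

theorem memory_two (i : Fin M) :
    (mpcAlgorithm n₀).memory S q input 2 i = (if M < n then
      (List.range n).map fun c => (allIncident input c).length else []) ++
      flatWords (input i) := by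
  rw [memory_succ, machineUpdate, if_neg one_ne_zero, if_pos rfl, memory_one]
  simp only [message_one]
  split_ifs with hM
  · rw [List.drop_left' (length_share _ _ _ _)]
    congr 1
    refine List.map_congr_left fun c hc => ?_
    rw [min_eq_left hM.le]
    exact gather_guarded_share i.pos le_rfl i.2 (List.mem_range.1 hc)
      (fun _ c => (allIncident input c).length)
  · rfl

theorem message_two (i j : Fin M) :
    (mpcAlgorithm n₀).message S q input 2 i j = routed (vertexOwner S input) j (input i) := by
  rw [message_eq, machineSend, if_neg two_ne_zero, if_neg (by norm_num), if_pos rfl]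
  have hdrop : ((mpcAlgorithm n₀).memory S q input 2 i).drop (if M < n then n else 0) =
      flatWords (input i) := by
    rw [memory_two]
    split_ifs
    · exact List.drop_left' (by simp)
    · rfl
  have hown : ∀ v : Fin n, owner n S M ((mpcAlgorithm n₀).memory S q input 2 i) v =
      vertexOwner S input v := by
    intro v
    rw [vertexOwner, owner, owner, memory_two]
    split_ifs
    · rw [List.take_append_of_le_length (by simp)]
    · rfl
  rw [hdrop, flatMap_range_flatWords (input i) fun u v => route n j
    (owner n S M ((mpcAlgorithm n₀).memory S q input 2 i) u)
    (owner n S M ((mpcAlgorithm n₀).memory S q input 2 i) v) u v]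
  simp only [hown]
  rfl

theorem memory_three (i : Fin M) :
    (mpcAlgorithm n₀).memory S q input 3 i = 0 :: received input (vertexOwner S input) i := by
  rw [memory_succ, machineUpdate, if_neg two_ne_zero, if_neg (by norm_num), if_pos rfl]
  simp only [message_two]
  rfl

theorem message_odd {t p : ℕ} {i : Fin M} (j : Fin M) {P : List ℕ}
    (h : (mpcAlgorithm n₀).memory S q input (2 * t + 3) i = p :: P) :
    (mpcAlgorithm n₀).message S q input (2 * t + 3) i j =
      guarded (min M n) i j (share n (min M n) j fun c =>
        localCost n₀ n q (n ^ (4 - t)) (p * n + c) P) := by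
  rw [message_eq, machineSend, if_neg (by omega), if_neg (by omega), if_neg (by omega),
    if_pos (by omega), h, show (2 * t + 3 - 3) / 2 = t by omega]
  rfl

theorem message_even {t p : ℕ} {i : Fin M} (j : Fin M) {P : List ℕ} {x : ℕ → ℕ}
    (h : (mpcAlgorithm n₀).memory S q input (2 * t + 4) i =
      p :: (share n (min M n) i x ++ P)) :
    (mpcAlgorithm n₀).message S q input (2 * t + 4) i j =
      guarded (min M n) i j (share n (min M n) i x) := by
  rw [message_eq, machineSend, if_neg (by omega), if_neg (by omega), if_neg (by omega),
    if_neg (by omega), h, List.drop_succ_cons, List.drop_zero,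
    List.take_left' (length_share _ _ _ _)]

variable (G) in
/-- The total cost of the block that is obtained from the chosen prefix by adding the digit `c`. -/
def levelCost (t c : ℕ) : ℕ :=
  ∑ i ∈ Finset.range (n ^ (4 - t)),
    graphCost G n₀ q ((chosenPrefix n (graphCost G n₀ q) t * n + c) * n ^ (4 - t) + i)

theorem levelCost_le (hn : 1 ≤ n) (t c : ℕ) : levelCost G n₀ q t c ≤ 2 * n ^ 8 := by
  rw [levelCost, ← sum_blockCost_eq]
  calc _ ≤ ∑ v : Fin n, 2 * n ^ 7 :=
        Finset.sum_le_sum fun v _ => blockCost_le (degree_le G v) hn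
    _ = 2 * n ^ 8 := by simp; ring

/-- The memory after round `2 * t + 2` holds the first `t` digits and the received words. -/
def HasPrefix (G : SimpleGraph (Fin n)) [DecidableRel G.Adj] (S : ℕ)
    (input : Fin M → List (Fin n × Fin n)) (n₀ q t : ℕ) : Prop :=
  ∃ p : Fin M → ℕ, ∀ i, (mpcAlgorithm n₀).memory S q input (2 * t + 3) i =
    p i :: received input (vertexOwner S input) i ∧ p i < n ^ t ∧
    ((i : ℕ) < min M n → p i = chosenPrefix n (graphCost G n₀ q) t)

/-- The participating machines agree on the prefix, so their partial costs refer to the same blocks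
and add up to the total costs. -/
theorem memory_even (h : IsDistribution G S input) (hn : 2 ≤ n) {t : ℕ} {p : Fin M → ℕ}
    (hp : ∀ i, (mpcAlgorithm n₀).memory S q input (2 * t + 3) i =
      p i :: received input (vertexOwner S input) i)
    (hp' : ∀ i : Fin M, (i : ℕ) < min M n → p i = chosenPrefix n (graphCost G n₀ q) t)
    (i : Fin M) :
    (mpcAlgorithm n₀).memory S q input (2 * t + 4) i =
      p i :: ((share n (min M n) i fun c =>
        if (i : ℕ) < min M n then levelCost G n₀ q t c else 0) ++
          received input (vertexOwner S input) i) := by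
  rw [memory_succ, machineUpdate, if_neg (by omega), if_neg (by omega), if_neg (by omega),
    if_pos (by omega), hp]
  simp only [fun j : Fin M => message_odd n₀ q i (hp j)]
  rw [combine_guarded_share n (min M n) i (fun j c => localCost n₀ n q (n ^ (4 - t))
    (p j * n + c) (received input (vertexOwner S input) j))]
  rw [List.getD_cons_zero, List.drop_succ_cons, List.drop_zero]
  congr 3
  funext c
  split_ifs with hi
  · rw [levelCost, ← sum_blockCost_eq, ← sum_localCost h hn]
    refine Finset.sum_congr rfl fun j _ => ?_
    simp only [hi, and_true]
    split_ifs with hj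
    · rw [hp' j hj]
    · rfl
  · simp [hi]

/-- Machines beyond the first `min M n` hold a meaningless prefix; it still satisfies `p i < n ^ t`,
which keeps their words short. -/
theorem memory_prefix (h : IsDistribution G S input) (hn : 2 ≤ n) (t : ℕ) :
    HasPrefix G S input n₀ q t := by
  induction t with
  | zero => exact ⟨fun _ => 0, fun i => ⟨memory_three n₀ q i, by simp, fun _ => rfl⟩⟩
  | succ t ih =>
    obtain ⟨p, hp⟩ := ih
    have hmem := memory_even n₀ q h hn (fun i => (hp i).1) (fun i => (hp i).2.2)
    let r : Fin M → List (List ℕ) := fun i =>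
      List.ofFn fun j : Fin M => (mpcAlgorithm n₀).message S q input (2 * t + 4) j i
    refine ⟨fun i => p i * n + select n fun c => gather (min M n) (r i) c, fun i => ⟨?_, ?_, ?_⟩⟩
    · rw [show 2 * (t + 1) + 3 = 2 * t + 4 + 1 by ring, memory_succ, machineUpdate,
        if_neg (by omega), if_neg (by omega), if_neg (by omega), if_neg (by omega), hmem,
        List.getD_cons_zero]
      congr 1
      rw [List.drop_succ_cons, List.drop_left' (length_share _ _ _ _)]
    · have h1 := select_lt (by omega : 0 < n) fun c => gather (min M n) (r i) c
      calc p i * n + _ < (p i + 1) * n := by rw [add_mul]; omega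
        _ ≤ n ^ t * n := Nat.mul_le_mul_right _ (hp i).2.1
        _ = n ^ (t + 1) := by ring
    · intro hi
      change p i * n + select n (fun c => gather (min M n) (r i) c) = _
      rw [chosenPrefix_succ, (hp i).2.2 hi]
      congr 1
      refine select_congr (fun c hc => ?_) (by omega)
      have hW : 0 < min M n := by omega
      have h2 := gather_guarded_share hW (min_le_left M n) hi hc fun j c =>
        if j < min M n then levelCost G n₀ q t c else 0
      rw [if_pos (Nat.mod_lt _ hW)] at h2
      rw [← levelCost, ← h2]
      simp only [r]
      congr 2
      funext j
      exact message_even n₀ q i (hmem j)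

/-! ### Resources of the MPC algorithm -/

theorem length_guarded_le {W i j k : ℕ} {l : List ℕ} (hl : l.length = k) :
    (guarded W i j l).length ≤ (if j < W then k else 0) ∧
      (guarded W i j l).length ≤ if i < W then k else 0 := by
  unfold guarded
  split_ifs <;> simp [hl]

theorem mem_of_mem_guarded {W i j x : ℕ} {l : List ℕ} (h : x ∈ guarded W i j l) : x ∈ l := by
  unfold guarded at h
  split_ifs at h
  · exact h
  · simp at h
  · simp at h

theorem le_of_mem_share {n W j x b : ℕ} {f : ℕ → ℕ} (h : x ∈ share n W j f) (hf : ∀ c, f c ≤ b) :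
    x ≤ b := by
  obtain ⟨k, -, rfl⟩ := List.mem_map.1 h
  exact hf _

theorem memory_bounds (h : IsDistribution G S input) (hn : 2 ≤ n) (hS : n ≤ S) {t : ℕ}
    (ht : t ≤ 13) (i : Fin M) :
    ((mpcAlgorithm n₀).memory S q input t i).length ≤ 6 * S ∧
      ∀ x ∈ (mpcAlgorithm n₀).memory S q input t i, x < n ^ 10 := by
  have hdiv : n / min M n ≤ n := Nat.div_le_self _ _
  have hflat : (flatWords (input i)).length ≤ S := (length_flatWords _).trans_le (h.2 i)
  have hrec := length_received_le h (by omega : 0 < S) i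
  have hpow : ∀ {x k : ℕ}, x < n ^ k → k ≤ 10 → x < n ^ 10 := fun hx hk =>
    hx.trans_le (Nat.pow_le_pow_right (by omega) hk)
  have hflatw : ∀ x ∈ flatWords (input i), x < n ^ 10 := fun x hx =>
    hpow (k := 1) (by simpa using lt_of_mem_flatWords hx) (by norm_num)
  have hdeg : ∀ c, (allIncident input c).length ≤ n := length_allIncident_le h
  have hn10 : n < n ^ 10 := by
    simpa using Nat.pow_lt_pow_right (by omega : 1 < n) (by norm_num : 1 < 10)
  have h8 := two_mul_pow_lt hn 8
  have hrecw : ∀ x ∈ received input (vertexOwner S input) i, x < n ^ 10 := fun x hx =>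
    hpow (lt_of_mem_received hx) (by norm_num)
  match t, ht with
  | 0, _ => exact ⟨by rw [memory_zero]; omega, hflatw⟩
  | 1, _ =>
    rw [memory_one]
    split_ifs
    · refine ⟨by rw [List.length_append, length_share]; omega, fun x hx => ?_⟩
      rcases List.mem_append.1 hx with hx | hx
      · exact (le_of_mem_share hx hdeg).trans_lt hn10
      · exact hflatw x hx
    · exact ⟨by rw [List.nil_append]; omega, hflatw⟩
  | 2, _ =>
    rw [memory_two]
    split_ifs
    · refine ⟨by rw [List.length_append, List.length_map, List.length_range]; omega,
        fun x hx => ?_⟩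
      rcases List.mem_append.1 hx with hx | hx
      · obtain ⟨c, -, rfl⟩ := List.mem_map.1 hx
        exact (hdeg c).trans_lt hn10
      · exact hflatw x hx
    · exact ⟨by rw [List.nil_append]; omega, hflatw⟩
  | t + 3, ht =>
    rcases Nat.even_or_odd' t with ⟨k, rfl | rfl⟩
    · obtain ⟨p, hp⟩ := memory_prefix n₀ q h hn k
      rw [(hp i).1]
      refine ⟨by rw [List.length_cons]; omega, fun x hx => ?_⟩
      rcases List.mem_cons.1 hx with rfl | hx
      -- Up to round `13` at most five digits have been chosen.
      · exact hpow (hp i).2.1 (by omega)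
      · exact hrecw x hx
    · obtain ⟨p, hp⟩ := memory_prefix n₀ q h hn k
      rw [show 2 * k + 1 + 3 = 2 * k + 4 by ring,
        memory_even n₀ q h hn (fun i => (hp i).1) (fun i => (hp i).2.2)]
      refine ⟨by rw [List.length_cons, List.length_append, length_share]; omega,
        fun x hx => ?_⟩
      rcases List.mem_cons.1 hx with rfl | hx
      · exact hpow (hp i).2.1 (by omega)
      rcases List.mem_append.1 hx with hx | hx
      · refine (le_of_mem_share hx fun c => ?_).trans_lt h8
        split_ifs
        · exact levelCost_le n₀ q (by omega) k c
        · exact Nat.zero_le _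
      · exact hrecw x hx

/-- Guarded messages of the length of a share respect the bandwidth. -/
theorem guarded_message_bounds (hS : n ≤ S) {t : ℕ} (l : Fin M → Fin M → List ℕ)
    (hl : ∀ i j, (l i j).length = n / min M n + 1)
    (hmsg : ∀ i j, (mpcAlgorithm n₀).message S q input t i j = guarded (min M n) i j (l i j))
    (hw : ∀ i j, ∀ x ∈ l i j, x < n ^ 10) (i : Fin M) :
    ∑ j, ((mpcAlgorithm n₀).message S q input t i j).length ≤ 6 * S ∧
      ∑ j, ((mpcAlgorithm n₀).message S q input t j i).length ≤ 6 * S ∧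
      ∀ j, ∀ x ∈ (mpcAlgorithm n₀).message S q input t i j, x < n ^ 10 := by
  simp only [hmsg]
  refine ⟨?_, ?_, fun j x hx => hw i j x (mem_of_mem_guarded hx)⟩
  · have := sum_guarded_length_le (min_le_right M n)
      (fun j => guarded (min M n) i j (l i j)) fun j => (length_guarded_le (hl i j)).1
    omega
  · have := sum_guarded_length_le (min_le_right M n)
      (fun j => guarded (min M n) j i (l j i)) fun j => (length_guarded_le (hl j i)).2
    omega

theorem message_bounds (h : IsDistribution G S input) (hn : 2 ≤ n) (hS : n ≤ S) (t : ℕ)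
    (i : Fin M) :
    ∑ j, ((mpcAlgorithm n₀).message S q input t i j).length ≤ 6 * S ∧
      ∑ j, ((mpcAlgorithm n₀).message S q input t j i).length ≤ 6 * S ∧
      ∀ j, ∀ x ∈ (mpcAlgorithm n₀).message S q input t i j, x < n ^ 10 := by
  have hn10 : n < n ^ 10 := by
    simpa using Nat.pow_lt_pow_right (by omega : 1 < n) (by norm_num : 1 < 10)
  have hdeg : ∀ c, (allIncident input c).length ≤ n := length_allIncident_le h
  have h8 := two_mul_pow_lt hn 8
  match t with
  | 0 =>
    by_cases hM : M < n
    · refine guarded_message_bounds n₀ q hS (fun i j => share n (min M n) j fun c =>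
        (incident (input i) c).length) (fun i j => length_share _ _ _ _)
        (fun i j => by rw [message_zero, if_pos hM]) (fun i j x hx => ?_) i
      refine (le_of_mem_share hx fun c => ?_).trans_lt hn10
      refine le_trans ?_ (hdeg c)
      rw [length_allIncident]
      exact Finset.single_le_sum (f := fun j => (incident (input j) c).length)
        (fun _ _ => Nat.zero_le _) (Finset.mem_univ i)
    · simp [message_zero, hM]
  | 1 =>
    by_cases hM : M < n
    · exact guarded_message_bounds n₀ q hS (fun i j => share n (min M n) i fun c =>
        (allIncident input c).length) (fun i j => length_share _ _ _ _)
        (fun i j => by rw [message_one, if_pos hM])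
        (fun i j x hx => (le_of_mem_share hx hdeg).trans_lt hn10) i
    · simp [message_one, hM]
  | 2 =>
    simp only [message_two]
    refine ⟨?_, ?_, fun j x hx => (lt_of_mem_routed hx).trans_le
      (Nat.pow_le_pow_right (by omega) (by norm_num))⟩
    -- The edges held by a machine take at most `S` words, and routing does not increase their
    -- number.
    · have := sum_length_routed_le (M := M) (vertexOwner S input) (input i)
      have := h.2 i
      omega
    · have h1 := length_received_le h (by omega : 0 < S) i
      rw [received, List.length_flatten, List.map_ofFn, List.sum_ofFn] at h1
      simp only [Function.comp] at h1
      omega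
  | t + 3 =>
    rcases Nat.even_or_odd' t with ⟨k, rfl | rfl⟩
    · obtain ⟨p, hp⟩ := memory_prefix n₀ q h hn k
      refine guarded_message_bounds n₀ q hS _ (fun i j => length_share _ _ _ _)
        (fun i j => message_odd n₀ q j (hp i).1) (fun i j x hx => ?_) i
      exact (le_of_mem_share hx fun c => localCost_received_le h _ (by omega) _ _ _ _ _).trans_lt h8
    · obtain ⟨p, hp⟩ := memory_prefix n₀ q h hn k
      have hmem := memory_even n₀ q h hn (fun i => (hp i).1) (fun i => (hp i).2.2)
      refine guarded_message_bounds n₀ q hS _ (fun i j => length_share _ _ _ _)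
        (fun i j => message_even n₀ q j (hmem i)) (fun i j x hx => ?_) i
      refine (le_of_mem_share hx fun c => ?_).trans_lt h8
      split_ifs
      · exact levelCost_le n₀ q (by omega) k c
      · exact Nat.zero_le _

theorem mpcAlgorithm_computes (h : IsDistribution G S input) (hn : 2 ≤ n) (hS : n ≤ S)
    (hM : 0 < M) :
    (mpcAlgorithm n₀).Computes S q input 13 (6 * S) (10 * (Nat.log 2 n + 1))
      (chosenSet G n₀ q) := by
  refine ⟨fun t ht i => ?_, fun t _ i => ?_, fun i => ?_, fun v => ?_⟩
  · have := memory_bounds n₀ q h hn hS ht i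
    exact ⟨this.1, fun x hx => size_le_of_lt_pow (this.2 x hx)⟩
  · have := message_bounds n₀ q h hn hS t i
    exact ⟨this.1, this.2.1, fun j x hx => size_le_of_lt_pow (this.2.2 j x hx)⟩
  · change (machineOutput n₀ n q i _).length ≤ _
    unfold machineOutput
    split_ifs
    · rw [List.length_flatMap]
      refine (List.sum_le_card_nsmul _ 1 ?_).trans ?_
      · intro x hx
        obtain ⟨v, -, rfl⟩ := List.mem_map.1 hx
        split_ifs <;> simp
      · simp; omega
    · exact Nat.zero_le _
  · obtain ⟨p, hp⟩ := memory_prefix n₀ q h hn 5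
    rw [mem_chosenSet]
    have hres : ∀ i : Fin M, (mpcAlgorithm n₀).result S q input 13 i =
        machineOutput n₀ n q i (p i :: received input (vertexOwner S input) i) := by
      intro i
      rw [← (hp i).1]
      rfl
    have h0 := (hp ⟨0, hM⟩).2.2 (by simp only; omega)
    simp only [hres, machineOutput, List.getD_cons_zero]
    constructor
    · intro hv
      refine ⟨⟨0, hM⟩, ?_⟩
      rw [if_pos rfl, h0]
      exact List.mem_flatMap.2 ⟨v, List.mem_range.2 v.2, by rw [if_pos hv]; simp⟩
    · rintro ⟨i, hi⟩
      split_ifs at hi with hi0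
      · obtain ⟨w, -, hw⟩ := List.mem_flatMap.1 hi
        have hi' : i = ⟨0, hM⟩ := Fin.ext hi0
        subst hi'
        rw [h0] at hw
        split_ifs at hw with hmem
        · rwa [List.mem_singleton.1 hw]
        · simp at hw
      · simp at hi

end MPC

/-! ### Real estimates and the main theorem -/

/-- Split `log ^ (4/3)` as `log * log ^ (1/3)`; once `log n ≥ 1` and the second factor reaches `11 /
a`, the right side is at least `11 * log n`. -/
theorem exists_threshold {a : ℝ} (ha : 0 < a) :
    ∃ n₁ : ℕ, ∀ n ≥ n₁, 10 * Real.log n + 1 ≤ a * Real.log n ^ (4 / 3 : ℝ) := by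
  have hlog : Filter.Tendsto (fun n : ℕ => Real.log n) Filter.atTop Filter.atTop :=
    Real.tendsto_log_atTop.comp tendsto_natCast_atTop_atTop
  have hpow : Filter.Tendsto (fun n : ℕ => Real.log n ^ (1 / 3 : ℝ)) Filter.atTop Filter.atTop :=
    (tendsto_rpow_atTop (by norm_num)).comp hlog
  obtain ⟨n₁, h⟩ := Filter.eventually_atTop.1
    ((hlog.eventually_ge_atTop 1).and (hpow.eventually_ge_atTop (11 / a)))
  refine ⟨n₁, fun n hn => ?_⟩
  obtain ⟨h1, h2⟩ := h n hn
  have h0 : 0 < Real.log n := by linarith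
  rw [show (4 / 3 : ℝ) = 1 + 1 / 3 by norm_num, Real.rpow_add h0, Real.rpow_one]
  rw [div_le_iff₀ ha] at h2
  nlinarith

theorem maxDegree_le_card_edgeFinset {V : Type*} [Fintype V] (G : SimpleGraph V)
    [DecidableRel G.Adj] [Fintype G.edgeSet] : G.maxDegree ≤ G.edgeFinset.card := by
  classical
  refine G.maxDegree_le_of_forall_degree_le _ fun v => ?_
  rw [← G.card_incidenceFinset_eq_degree]
  refine Finset.card_le_card fun e he => ?_
  rw [SimpleGraph.mem_edgeFinset]
  exact ((G.mem_incidenceFinset v e).1 he).1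

/-- Neighbourhoods of size at least `q * x` are large in the sense of the table if `x` exceeds
`10 * log n`. -/
theorem pow_six_le_two_pow_div {n q d : ℕ} {x : ℝ} (hn : 1 ≤ n) (hq : 1 ≤ q)
    (hx : 10 * Real.log n + 1 ≤ x) (hd : q * x ≤ d) : n ^ 6 ≤ 2 ^ (d / q) := by
  have hq' : (0 : ℝ) < q := by exact_mod_cast hq
  have h1 : x ≤ d / q := by rw [le_div_iff₀ hq']; linarith
  have h2 : (d / q : ℝ) < (d / q : ℕ) + 1 := by
    rw [div_lt_iff₀ hq']
    exact_mod_cast (by rw [mul_comm]; exact Nat.lt_mul_div_succ d hq : d < (d / q + 1) * q)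
  have hlog : 0 ≤ Real.log n := Real.log_natCast_nonneg n
  have hl2 : (0.6 : ℝ) ≤ Real.log 2 := by linarith [Real.log_two_gt_d9]
  have h3 : Real.log ((n : ℝ) ^ 6) ≤ Real.log ((2 : ℝ) ^ (d / q)) := by
    rw [Real.log_pow, Real.log_pow]
    -- The `+ 1` in the hypothesis pays for rounding `d / q` down; then `10 * log 2 ≥ 6` suffices.
    have h4 : 10 * Real.log n ≤ ((d / q : ℕ) : ℝ) := by linarith
    push_cast at h4 ⊢
    nlinarith
  have hn' : (0 : ℝ) < n := by exact_mod_cast hn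
  exact_mod_cast (Real.log_le_log_iff (by positivity) (by positivity)).1 h3

theorem mainTheorem2 (ε : ℝ) (hε : 0 < ε) (c : ℝ) (hc : 0 < c) :
    ∃ (A : CliqueAlgorithm) (B : MPCAlgorithm) (β : ℝ) (R₁ R₂ C b : ℕ),
      ∀ (n : ℕ) (G : SimpleGraph (Fin n)) [DecidableRel G.Adj] (f : ℝ),
        c * Real.log n ^ (4 / (3 * ε)) ≤ (G.maxDegree : ℝ) →
        1 ≤ f → f ≤ √(G.maxDegree : ℝ) →
        ∃ Z : Finset (Fin n),
          ((G.induce (Z : Set (Fin n))).edgeSet.ncard : ℝ) ≤ β * (G.edgeSet.ncard / f ^ 2) ∧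
          (∀ v : Fin n, v ∉ Z → f * (G.maxDegree : ℝ) ^ ε ≤ (G.degree v : ℝ) →
            ∃ u ∈ Z, G.Adj v u) ∧
          A.Computes G ⌊f⌋₊ R₁ (b * (Nat.log 2 n + 1)) Z ∧
          ∀ (S M : ℕ) (input : Fin M → List (Fin n × Fin n)),
            n ≤ S → IsDistribution G S input →
            B.Computes S ⌊f⌋₊ input R₂ (C * S) (b * (Nat.log 2 n + 1)) Z := by
  obtain ⟨n₁, hn₁⟩ := exists_threshold (Real.rpow_pos_of_pos hc ε)
  -- Beyond `n₁` the degree condition makes neighbourhoods large in the sense of the table; `17`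
  -- lets a penalty exceed the average cost.
  obtain ⟨n₀, hn₀⟩ : ∃ n₀, n₀ = max n₁ 17 := ⟨_, rfl⟩
  refine ⟨cliqueAlgorithm n₀, mpcAlgorithm n₀, 34 + n₀, 10, 13, 6, 10, ?_⟩
  intro n G _ f hΔ hf1 hfΔ
  have hfpos : 0 < f := by linarith
  have hf2 : f ^ 2 ≤ G.maxDegree := (Real.le_sqrt' hfpos).1 hfΔ
  have hΔ1 : 1 ≤ G.maxDegree := by
    have : (1 : ℝ) ≤ G.maxDegree := by nlinarith
    exact_mod_cast this
  have hn0 : n ≠ 0 := by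
    rintro rfl
    simp [SimpleGraph.maxDegree] at hΔ1
  have : Nonempty (Fin n) := ⟨⟨0, Nat.pos_of_ne_zero hn0⟩⟩
  have hΔn : G.maxDegree < n := by simpa using G.maxDegree_lt_card_verts
  have hn : 2 ≤ n := by omega
  have hm : G.maxDegree ≤ G.edgeFinset.card := maxDegree_le_card_edgeFinset G
  have hcard : G.edgeSet.ncard = G.edgeFinset.card := by
    rw [← SimpleGraph.coe_edgeFinset, Set.ncard_coe_finset]
  obtain ⟨q, hqdef⟩ : ∃ q, q = ⌊f⌋₊ := ⟨_, rfl⟩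
  have hqf : (q : ℝ) ≤ f := hqdef ▸ Nat.floor_le hfpos.le
  have hfq : f < q + 1 := hqdef ▸ Nat.lt_floor_add_one f
  have hq : 1 ≤ q := by rw [hqdef]; exact Nat.one_le_floor_iff f |>.2 hf1
  have hq1 : (1 : ℝ) ≤ q := by exact_mod_cast hq
  have hqΔ : q ^ 2 ≤ G.maxDegree := by
    have : (q : ℝ) ^ 2 ≤ G.maxDegree := (pow_le_pow_left₀ (by linarith) hqf 2).trans hf2
    exact_mod_cast this
  rw [← hqdef]
  have hmem := mem_chosenSet G n₀ q
  -- The graph has an edge, and some machine must hold it.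
  have hMpos : ∀ (S M : ℕ) (input : Fin M → List (Fin n × Fin n)),
      IsDistribution G S input → 0 < M := by
    intro S M input h
    by_contra hM
    have hM0 : M = 0 := by omega
    subst hM0
    obtain ⟨e, he⟩ := Finset.card_pos.1 (by omega : 0 < G.edgeFinset.card)
    have := h.1 e
    rw [if_pos (SimpleGraph.mem_edgeFinset.1 he)] at this
    simp at this
  refine ⟨chosenSet G n₀ q, ?_, ?_, cliqueAlgorithm_computes G n₀ q hn,
    fun S M input hS h => mpcAlgorithm_computes n₀ q h hn hS (hMpos S M input h)⟩
  · rw [← mul_div_assoc, le_div_iff₀ (by positivity), hcard]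
    rcases lt_or_ge n n₀ with hlt | hge
    · have h1 : (G.induce (chosenSet G n₀ q : Set (Fin n))).edgeSet.ncard ≤
          G.edgeFinset.card := by
        rw [← hcard]
        exact Set.ncard_le_ncard_of_injOn (Sym2.map Subtype.val)
          (fun e he => by
            induction e with
            | h a b => simpa using he)
          (Sym2.map.injective Subtype.val_injective).injOn (Set.toFinite _)
      -- For small `n` the trivial bound by `m` is enough, because `f ^ 2 ≤ Δ < n₀`.
      have h2 : f ^ 2 ≤ 34 + n₀ := by
        have : (G.maxDegree : ℝ) ≤ n₀ := by exact_mod_cast (hΔn.trans hlt).le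
        linarith
      rw [mul_comm (34 + (n₀ : ℝ))]
      exact mul_le_mul (by exact_mod_cast h1) h2 (by positivity) (by positivity)
    · have h1 := (chosen_set_spec G hge (by omega) hq (hqΔ.trans hΔn.le) (hqΔ.trans hm) _
        hmem).1
      have h2 : (2 * q ^ 2 * ((G.induce (chosenSet G n₀ q : Set (Fin n))).edgeSet.ncard : ℝ)) ≤
          17 * G.edgeFinset.card := by exact_mod_cast h1
      -- From `f < q + 1 ≤ 2q`; together with `17 / 2` this yields the constant `34`.
      have h3 : f ^ 2 ≤ 4 * q ^ 2 := by nlinarith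
      calc _ ≤ ((G.induce (chosenSet G n₀ q : Set (Fin n))).edgeSet.ncard : ℝ) * (4 * q ^ 2) := by
            gcongr
        _ = 2 * (2 * q ^ 2 *
            ((G.induce (chosenSet G n₀ q : Set (Fin n))).edgeSet.ncard : ℝ)) := by ring
        _ ≤ 34 * G.edgeFinset.card := by linarith
        _ ≤ (34 + n₀) * G.edgeFinset.card := by
            gcongr
            linarith [Nat.cast_nonneg (α := ℝ) n₀]
  · intro v hv hdeg
    rcases lt_or_ge n n₀ with hlt | hge
    · exact absurd ((hmem v).2 (if_pos hlt)) hv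
    · refine (chosen_set_spec G hge (by omega) hq (hqΔ.trans hΔn.le) (hqΔ.trans hm) _
        hmem).2 v ?_
      have hlog : 0 ≤ Real.log n := Real.log_natCast_nonneg n
      -- Raising the degree condition to the power `ε` turns its exponent into `4 / 3`, whatever `ε`
      -- is.
      have h1 : c ^ ε * Real.log n ^ (4 / 3 : ℝ) ≤ (G.maxDegree : ℝ) ^ ε := by
        have h2 := Real.rpow_le_rpow (by positivity) hΔ hε.le
        rwa [Real.mul_rpow hc.le (by positivity), ← Real.rpow_mul hlog,
          show 4 / (3 * ε) * ε = 4 / 3 by field_simp] at h2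
      refine pow_six_le_two_pow_div (by omega) hq ((hn₁ n (by omega)).trans h1) ?_
      exact (mul_le_mul_of_nonneg_right hqf (by positivity)).trans hdeg
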